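/- Fix a field $k$. For a scheme $\overline{X}$ of finite type over $k$ and an effective Cartier divisor $D$ on $\overline{X}$, let $Z_0(X)$ be the group of $0$-cycles on $X=\overline{X}\setminus|D|$. For an integral scheme $\overline{C}$ and a closed subscheme $E\subset\overline{C}$ let $$G(\overline{C},E)=\bigcap_{x\in E}\ker\bigl(\mathcal{O}_{\overline{C},x}^{\times}\to\mathcal{O}_{E,x}^{\times}\bigr)\subset k(\overline{C})^{\times}.$$ The Chow group $\mathrm{CH}_0(\overline{X}|D)$ of $0$-cycles with modulus is the quotient of $Z_0(X)$ by the subgroup generated by the cycles $\varphi_*\mathrm{div}_{\overline{C}}(f)$, where $\varphi\colon\overline{C}\to\overline{X}$ runs over all finite morphisms from integral normal curves with $\varphi(\overline{C})\not\subset D$, and $f$ over $G(\overline{C},\varphi^*D)$. **Proposition.** Let $\overline{X},\overline{Y}$ be proper schemes over $k$ and let $D,E$ be effective Cartier divisors on $\overline{X},\overline{Y}$ respectively. Assume that $\overline{Y}$ is connected and that $Y=\overline{Y}\setminus|E|$ has a $k$-rational point. If, for every finite field extension $k'/k$, the degree map on $0$-cycles induces an isomorphism $\mathrm{CH}_0(\overline{Y}_{k'}|E_{k'})\xrightarrow{\simeq}\mathbb{Z}$,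 then push-forward of $0$-cycles along the projection $p_1\colon\overline{X}\times_k\overline{Y}\to\overline{X}$ induces a well-defined isomorphism $$p_{1,*}\colon\mathrm{CH}_0(\overline{X}\times\overline{Y}\,|\,\overline{X}\times E+D\times\overline{Y})\xrightarrow{\simeq}\mathrm{CH}_0(\overline{X}|D).$$ Moreover, for every proper $k$-scheme $\overline{X}$ with an effective Cartier divisor $D$, push-forward along the projection $p_1\colon\overline{X}\times_k\mathbb{P}^1_k\to\overline{X}$ induces an isomorphism $$p_{1,*}\colon\mathrm{CH}_0(\overline{X}\times\mathbb{P}^1\,|\,D\times\mathbb{P}^1)\xrightarrow{\simeq}\mathrm{CH}_0(\overline{X}|D).$$ -/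

import Mathlib

open AlgebraicGeometry CategoryTheory CategoryTheory.Limits

universe u

noncomputable section

namespace ChowModulus

/-- A closed subscheme (given by its quasi-coherent ideal sheaf `D`) is an effective Cartier
divisor if the ideal is locally generated by one nonzerodivisor. -/
def IsEffectiveCartier {X : Scheme.{u}} (D : X.IdealSheafData) : Prop :=
  ∀ x : X, ∃ U : X.affineOpens, x ∈ U.1 ∧
    ∃ f ∈ nonZeroDivisors Γ(X, U.1), D.ideal U = Ideal.span {f}

/-- The closed points of the open complement `X ∖ |D|`. For `X` of finite type over a field
these are the closed points of `X` that do not lie on `|D|`. -/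
def ClosedPointOff (X : Scheme.{u}) (D : X.IdealSheafData) : Type u :=
  {x : X // IsClosed ({x} : Set X) ∧ x ∉ D.support}

/-- The group of zero-cycles on the open complement `X ∖ |D|`. -/
abbrev ZeroCycle (X : Scheme.{u}) (D : X.IdealSheafData) : Type u :=
  ClosedPointOff X D →₀ ℤ

/-- A proper morphism `f : X' ⟶ X` with `f⁻¹ D ⊆ D'` as closed subschemes maps closed points of
`X' ∖ |D'|` to closed points of `X ∖ |D|`. -/
def ClosedPointOff.map {X' X : Scheme.{u}} (f : X' ⟶ X) [IsProper f] {D' : X'.IdealSheafData}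
    {D : X.IdealSheafData} (h : D' ≤ D.comap f) (x : ClosedPointOff X' D') :
    ClosedPointOff X D :=
  ⟨f x.1, by simpa using f.isClosedMap _ x.2.1, fun hx => x.2.2 <| by
    have h1 : x.1 ∈ (D.comap f).support := by
      rw [Scheme.IdealSheafData.support_comap]
      exact hx
    exact Scheme.IdealSheafData.support_antitone h h1⟩

/-- Proper push-forward of zero-cycles, `[x] ↦ [κ(x) : κ(f x)] [f x]`. -/
def pushforward {X' X : Scheme.{u}} (f : X' ⟶ X) [IsProper f] {D' : X'.IdealSheafData}
    {D : X.IdealSheafData} (h : D' ≤ D.comap f) : ZeroCycle X' D' →+ ZeroCycle X D :=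
  Finsupp.liftAddHom fun x =>
    (Finsupp.singleAddHom (x.map f h)).comp (AddMonoidHom.mulLeft (f.residueDegree x.1 : ℤ))

/-- The degree of a zero-cycle with respect to a structure morphism `π : X ⟶ Spec k`,
`[x] ↦ [κ(x) : k]`. -/
def degree {X : Scheme.{u}} {k : Type u} [Field k] (π : X ⟶ Spec (.of k))
    (D : X.IdealSheafData) : ZeroCycle X D →+ ℤ :=
  Finsupp.liftAddHom fun x => AddMonoidHom.mulLeft (π.residueDegree x.1 : ℤ)

/-- A nonzero rational function on an integral Noetherian scheme has a nonzero order at only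
finitely many points of codimension one. -/
theorem finite_ord_ne_zero (C : Scheme.{u}) [IsIntegral C] [IsNoetherian C]
    (f : C.functionField) : {x : C | Scheme.ord f x ≠ 0}.Finite := by
  by_cases hf : f = 0
  · simp [hf]
  obtain ⟨U, hU, hxU, -⟩ := exists_isAffineOpen_mem_and_subset
    (x := genericPoint C) (U := ⊤) trivial
  have : Nonempty U := ⟨⟨_, hxU⟩⟩
  have := functionField_isFractionRing_of_isAffineOpen C U hU
  obtain ⟨a, b, hb, hab⟩ := IsFractionRing.div_surjective (A := Γ(C, U)) f
  have hb0 : b ≠ 0 := nonZeroDivisors.ne_zero hb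
  have ha0 : a ≠ 0 := by
    rintro rfl
    simp at hab
    exact hf hab.symm
  have hK (c : Γ(C, U)) (hc : c ≠ 0) : C.germToFunctionField U c ≠ 0 := by
    rw [Ne, map_eq_zero_iff _ (Scheme.germToFunctionField_injective C U)]
    exact hc
  have hne : (C.basicOpen (a * b) : Set C).Nonempty := by
    rw [Set.nonempty_iff_ne_empty]
    intro h
    have h' : C.basicOpen (a * b) = ⊥ := by ext1; exact h
    rw [basicOpen_eq_bot_iff] at h'
    exact mul_ne_zero ha0 hb0 h'
  have hgen : genericPoint C ∈ C.basicOpen (a * b) :=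
    ((genericPoint_spec C).mem_open_set_iff (C.basicOpen (a * b)).isOpen).mpr (by simpa using hne)
  have hunit (c : Γ(C, U)) (x : C) (hx : x ∈ C.basicOpen c) :
      Scheme.ord (C.germToFunctionField U c) x = 0 := by
    have hg : genericPoint C ∈ C.basicOpen c :=
      ((genericPoint_spec C).mem_open_set_iff (C.basicOpen c).isOpen).mpr ⟨x, trivial, hx⟩
    have : Nonempty (C.basicOpen c) := ⟨⟨_, hg⟩⟩
    have h1 := RingedSpace.isUnit_res_basicOpen C.toRingedSpace c
    have h2 := Scheme.ord_of_isUnit (X := C) (U := C.basicOpen c) h1 hx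
    convert h2 using 2
    exact (TopCat.Presheaf.germ_res_apply C.presheaf
      (homOfLE (C.basicOpen_le c)) (genericPoint C) hg c).symm
  have hord (x : C) (hx : x ∈ C.basicOpen (a * b)) : Scheme.ord f x = 0 := by
    rw [Scheme.basicOpen_mul] at hx
    have h1 : f * C.germToFunctionField U b = C.germToFunctionField U a := by
      rw [← hab]
      exact div_mul_cancel₀ _ (hK b hb0)
    have h2 := Scheme.ord_mul (x := x) hf (hK b hb0)
    rw [h1, hunit a x hx.1, hunit b x hx.2] at h2
    omega
  let Z : TopologicalSpace.Closeds C := (C.basicOpen (a * b)).compl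
  obtain ⟨S, hSf, hSc, hSi, hSZ⟩ :=
    TopologicalSpace.NoetherianSpace.exists_finite_set_isClosed_irreducible Z.isClosed
  have hZ (x : C) (hx : x ∉ C.basicOpen (a * b)) : ∃ T ∈ S, x ∈ T := by
    have : x ∈ (Z : Set C) := hx
    rw [hSZ] at this
    simpa using this
  have hg (T : S) : ∃ η : C, IsGenericPoint η T.1 :=
    QuasiSober.sober (hSi T.1 T.2) (hSc T.1 T.2)
  choose η hη using hg
  have : Finite S := hSf
  refine (Set.finite_range η).subset fun x hx => ?_
  have hx1 : x ∉ C.basicOpen (a * b) := fun h => hx (hord x h)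
  obtain ⟨T, hT, hxT⟩ := hZ x hx1
  refine ⟨⟨T, hT⟩, ?_⟩
  by_contra hne'
  have hco : Order.coheight x = 1 := by
    by_contra h
    exact hx (Scheme.ord_eq_zero_of_coheight_neq_one h f)
  set e := η ⟨T, hT⟩ with he
  have hsp : e ⤳ x := (hη ⟨T, hT⟩).specializes hxT
  have heZ : e ∉ C.basicOpen (a * b) := by
    have h1 : e ∈ T := (hη ⟨T, hT⟩).mem
    have h2 : e ∈ (Z : Set C) := by
      rw [hSZ]
      exact ⟨T, hT, h1⟩
    exact h2
  have h1 : x < e := by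
    refine ⟨hsp, fun h => hne' ?_⟩
    exact (hsp.antisymm (Scheme.le_iff_specializes.mp h)).eq
  have h2 : e < genericPoint C := by
    refine ⟨genericPoint_specializes e, fun h => heZ ?_⟩
    exact (Scheme.le_iff_specializes.mp h).mem_open (C.basicOpen (a * b)).isOpen hgen
  have h3 := Order.coheight_add_one_le h1
  have h4 := Order.coheight_add_one_le h2
  rw [hco] at h3
  have h5 : (1 : ℕ∞) ≤ Order.coheight e := le_trans (by simp) h4
  have h6 : (1 : ℕ∞) + 1 ≤ 1 := le_trans (by gcongr) h3
  exact absurd h6 (by decide)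

/-- The part of the divisor of the rational function `f` on the curve `C` that lies outside
`|E|`; for `f` satisfying the modulus condition with respect to `E` this is the whole divisor,
since such an `f` is a unit near `|E|`. -/
def divisor (C : Scheme.{u}) [IsIntegral C] [IsNoetherian C] (E : C.IdealSheafData)
    (f : C.functionField) : ZeroCycle C E :=
  Finsupp.ofSupportFinite (fun x => Scheme.ord f x.1)
    ((finite_ord_ne_zero C f).preimage Subtype.val_injective.injOn)

/-- The group of rational functions on `C` satisfying the modulus condition with respect to `E`:
the intersection in `k(C)ˣ`, over all points `x` of the closed subscheme `E`, of
the kernels of `𝒪_{C,x}ˣ → 𝒪_{E,x}ˣ`. -/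
def modulusGroup (C : Scheme.{u}) [IsIntegral C] (E : C.IdealSheafData) :
    Subgroup (C.functionField : Type u)ˣ :=
  ⨅ x : E.subscheme,
    (Units.map (E.subschemeι.stalkMap x).hom.toMonoidHom).ker.map
      (Units.map (algebraMap (C.presheaf.stalk (E.subschemeι x)) C.functionField).toMonoidHom)

/-- A finite morphism `φ : C ⟶ X` from an integral normal curve with `φ(C) ⊄ D`. When `X` is of
finite type over a field, so is `C` (and it is separated over the field if `X` is), via `φ`, and
it is automatically Noetherian. -/
structure FiniteCurve (X : Scheme.{u}) (D : X.IdealSheafData) where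
  C : Scheme.{u}
  φ : C ⟶ X
  isIntegral : IsIntegral C
  isNoetherian : IsNoetherian C
  normal : ∀ x : C, IsIntegrallyClosed (C.presheaf.stalk x)
  dim_eq_one : topologicalKrullDim C = 1
  isFinite : IsFinite φ
  not_subset : ¬ Set.range φ ⊆ (D.support : Set X)

attribute [instance] FiniteCurve.isIntegral FiniteCurve.isNoetherian FiniteCurve.isFinite

/-- The zero-cycle `φ_* div(f)` on `X ∖ |D|`. -/
def FiniteCurve.tau {X : Scheme.{u}} {D : X.IdealSheafData} (W : FiniteCurve X D)
    (f : W.C.functionField) : ZeroCycle X D :=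
  pushforward W.φ (le_refl (D.comap W.φ)) (divisor W.C (D.comap W.φ) f)

/-- The subgroup of `ZeroCycle X D` generated by the cycles `φ_* div(f)`, for all finite morphisms
`φ : C ⟶ X` from integral normal curves with `φ(C) ⊄ D` and all rational functions `f` on `C`
satisfying the modulus condition with respect to `φ^* D`. -/
def modulusRelations (X : Scheme.{u}) (D : X.IdealSheafData) : AddSubgroup (ZeroCycle X D) :=
  AddSubgroup.closure {z | ∃ W : FiniteCurve X D, ∃ f ∈ modulusGroup W.C (D.comap W.φ),
    z = W.tau (f : W.C.functionField)}

/-- The Chow group `CH₀(X|D)` of zero-cycles on `X` with modulus `D`. -/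
abbrev CH0 (X : Scheme.{u}) (D : X.IdealSheafData) : Type u :=
  ZeroCycle X D ⧸ modulusRelations X D

/-- The class of a zero-cycle in the Chow group with modulus. -/
abbrev CH0.mk {X : Scheme.{u}} {D : X.IdealSheafData} : ZeroCycle X D →+ CH0 X D :=
  QuotientAddGroup.mk' (modulusRelations X D)

/-- The degree map on zero-cycles induces an isomorphism `CH₀(X|D) ≃ ℤ`. -/
def DegreeInducesIso {X : Scheme.{u}} {k : Type u} [Field k] (π : X ⟶ Spec (.of k))
    (D : X.IdealSheafData) : Prop :=
  ∃ e : CH0 X D ≃+ ℤ, ∀ z : ZeroCycle X D, e (CH0.mk z) = degree π D z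

/-- Push-forward of zero-cycles along the proper morphism `f` induces a (well-defined)
isomorphism `CH₀(X'|D') ≃ CH₀(X|D)`. -/
def PushforwardInducesIso {X' X : Scheme.{u}} (f : X' ⟶ X) [IsProper f] {D' : X'.IdealSheafData}
    {D : X.IdealSheafData} (h : D' ≤ D.comap f) : Prop :=
  ∃ e : CH0 X' D' ≃+ CH0 X D, ∀ z : ZeroCycle X' D', e (CH0.mk z) = CH0.mk (pushforward f h z)

section Product

variable {X Y S : Scheme.{u}} (πX : X ⟶ S) (πY : Y ⟶ S)

/-- The divisor `X × E + D × Y` on `X × Y`: the sum of divisors corresponds to the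
product of ideal sheaves. -/
def prodDivisor (D : X.IdealSheafData) (E : Y.IdealSheafData) :
    (pullback πX πY).IdealSheafData :=
  E.comap (pullback.snd πX πY) * D.comap (pullback.fst πX πY)

theorem prodDivisor_le (D : X.IdealSheafData) (E : Y.IdealSheafData) :
    prodDivisor πX πY D E ≤ D.comap (pullback.fst πX πY) :=
  fun _ => Ideal.mul_le_right

end Product

section BaseChange

variable {Y : Scheme.{u}} {k : Type u} [Field k] (πY : Y ⟶ Spec (.of k))
  (k' : Type u) [Field k'] [Algebra k k']

/-- The base change `Y_{k'}`. -/
abbrev baseChange : Scheme.{u} :=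
  pullback πY (Spec.map (CommRingCat.ofHom (algebraMap k k')))

/-- The structure morphism `Y_{k'} ⟶ Spec k'`. -/
abbrev baseChangeStr : baseChange πY k' ⟶ Spec (.of k') :=
  pullback.snd πY (Spec.map (CommRingCat.ofHom (algebraMap k k')))

/-- The base change `E_{k'}` of a closed subscheme. -/
abbrev baseChangeDivisor (E : Y.IdealSheafData) : (baseChange πY k').IdealSheafData :=
  E.comap (pullback.fst πY (Spec.map (CommRingCat.ofHom (algebraMap k k'))))

end BaseChange

section ProjectiveLine

attribute [local instance] MvPolynomial.gradedAlgebra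

variable (k : Type u) [Field k]

/-- The projective line `ℙ¹ = Proj k[x₀, x₁]` over `k`. -/
def projLine : Scheme.{u} := Proj (MvPolynomial.homogeneousSubmodule (Fin 2) k)

/-- The structure morphism `ℙ¹ ⟶ Spec k`. -/
def projLineStr : projLine k ⟶ Spec (.of k) :=
  Proj.toSpecZero (MvPolynomial.homogeneousSubmodule (Fin 2) k) ≫
    Spec.map (CommRingCat.ofHom
      (algebraMap k (MvPolynomial.homogeneousSubmodule (Fin 2) k 0)))

instance : IsProper (projLineStr k) := by
  have hs : Function.Surjective
      (algebraMap k (MvPolynomial.homogeneousSubmodule (Fin 2) k 0)) := by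
    rintro ⟨p, hp⟩
    have h := (MvPolynomial.totalDegree_zero_iff_isHomogeneous (p := p)).mpr hp
    rw [MvPolynomial.totalDegree_eq_zero_iff_eq_C] at h
    exact ⟨_, Subtype.ext h.symm⟩
  have : IsScalarTower k (MvPolynomial.homogeneousSubmodule (Fin 2) k 0)
      (MvPolynomial (Fin 2) k) :=
    IsScalarTower.of_algebraMap_eq (R := k) (S := MvPolynomial.homogeneousSubmodule (Fin 2) k 0)
      (A := MvPolynomial (Fin 2) k) fun _ => rfl
  have : Algebra.FiniteType (MvPolynomial.homogeneousSubmodule (Fin 2) k 0)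
      (MvPolynomial (Fin 2) k) :=
    Algebra.FiniteType.of_restrictScalars_finiteType k _ _
  have : IsClosedImmersion (Spec.map (CommRingCat.ofHom
      (algebraMap k (MvPolynomial.homogeneousSubmodule (Fin 2) k 0)))) :=
    IsClosedImmersion.spec_of_surjective _ hs
  have h1 : IsProper (Proj.toSpecZero (MvPolynomial.homogeneousSubmodule (Fin 2) k)) :=
    inferInstance
  have h2 : IsFinite (Spec.map (CommRingCat.ofHom
      (algebraMap k (MvPolynomial.homogeneousSubmodule (Fin 2) k 0)))) := inferInstance
  have h3 : IsProper (Spec.map (CommRingCat.ofHom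
      (algebraMap k (MvPolynomial.homogeneousSubmodule (Fin 2) k 0)))) := inferInstance
  exact MorphismProperty.comp_mem @IsProper _ _ h1 h3

end ProjectiveLine

end ChowModulus

end

open ChowModulus

/-!
Write `S = X × Y` and let `p` be the first projection. The inverse of push-forward along `p` is
push-forward along the section `s = (id, y)` given by the rational point `y`
(`pushforwardInducesIso_fst_of_degree`); three facts are needed.

* Push-forward along `p` respects the relations. Let `C ⟶ S` be one of the curves defining them. If
  `C ⟶ X` is not constant with closed image, it is proper with finite fibres, hence finite
  (`isFinite_of_not_contracted`), and `C` defines a relation on `X`. Otherwise `C` lies in the fibre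
  `Y_K` over a closed point `x` off `|D|` with residue field `K`; the relation is one on `Y_K` for the
  divisor `E_K`, so its degree, and with it its push-forward to `x`, vanishes
  (`pushforward_tau_eq_zero_of_contracted`).
* Push-forward along the closed immersion `s` respects the relations, and `p ∘ s = id`.
* Push-forward along `s` is surjective on classes: a closed point of `S` lies in some `Y_K`, where it
  is equivalent to a multiple of the rational point `y_K`, since both are determined by their degree
  (`exists_mk_eq_mk_pushforward_sectionMap`).

For the projective line and the empty divisor it remains to see that the degree map is an
isomorphism over every field (`degreeInducesIso_of_projectiveLineCharts`). A closed point
`q(t) = 0` differs from `deg q · [∞]` by the divisor of `q`, so the degree is injective, and it is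
onto because `∞` is rational. It is well defined because the push-forward of a principal divisor
`div f` along a finite morphism of curves `C ⟶ ℙ¹` is the divisor of the norm of `f`
(`exists_cycleMap_principalCycle_eq`), and principal divisors on `ℙ¹` have degree zero. The norm
formula is local on `ℙ¹`, where the ring of functions is a principal ideal domain: the order of a
norm is a length by the Smith normal form, and this length splits into local contributions by
dévissage (`ord_norm_eq_sum`).

All of this uses only that a projective line is covered by two affine lines whose coordinates are
inverse to each other. The structure `ProjectiveLineCharts` records this description; it is stable
under extension of the base field, and `Proj k[x₀, x₁]` has it (`projLineCharts`).
-/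

noncomputable section

namespace ChowModulus

/-! ### Residue degrees -/

section ResidueDegree

variable {X Y Z : Scheme.{u}}

/-- The tower law for residue degrees. -/
theorem residueDegree_comp (f : X ⟶ Y) (g : Y ⟶ Z) (x : X) :
    (f ≫ g).residueDegree x = g.residueDegree (f x) * f.residueDegree x := by
  let := (f.residueFieldMap x).hom.toAlgebra
  let := (g.residueFieldMap (f x)).hom.toAlgebra
  let : Algebra (Z.residueField (g (f x))) (X.residueField x) :=
    ((f ≫ g).residueFieldMap x).hom.toAlgebra
  have : IsScalarTower (Z.residueField (g (f x))) (Y.residueField (f x)) (X.residueField x) :=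
    IsScalarTower.of_algebraMap_eq' (by
      change ((f ≫ g).residueFieldMap x).hom = _
      rw [Scheme.residueFieldMap_comp]
      rfl)
  exact (Module.finrank_mul_finrank (Z.residueField (g (f x))) (Y.residueField (f x))
    (X.residueField x)).symm

/-- Immersions do not change residue fields: surjectivity on stalks already forces residue degree
one. -/
theorem residueDegree_eq_one (f : X ⟶ Y) [SurjectiveOnStalks f] (x : X) :
    f.residueDegree x = 1 := by
  let := (f.residueFieldMap x).hom.toAlgebra
  have hs : Function.Surjective (f.residueFieldMap x).hom := by
    intro a
    obtain ⟨b, rfl⟩ := X.residue_surjective x a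
    obtain ⟨c, rfl⟩ := f.stalkMap_surjective x b
    exact ⟨Y.residue (f x) c, congr($(Scheme.residue_residueFieldMap f x) c)⟩
  have e := LinearEquiv.ofBijective
    (Algebra.linearMap (Y.residueField (f x)) (X.residueField x))
    ⟨(f.residueFieldMap x).hom.injective, hs⟩
  exact e.finrank_eq.symm.trans (Module.finrank_self _)

end ResidueDegree

/-! ### Cycles on the whole scheme -/

section Cycles

variable {X Y Z : Scheme.{u}}

/-- Push-forward of cycles `[x] ↦ [κ(x) : κ(f x)] [f x]` on formal combinations of arbitrary
points. -/
def cycleMap (f : X ⟶ Y) : (X →₀ ℤ) →+ (Y →₀ ℤ) :=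
  Finsupp.liftAddHom fun x =>
    (Finsupp.singleAddHom (f x)).comp (AddMonoidHom.mulLeft (f.residueDegree x : ℤ))

/-- The degree `[x] ↦ [κ(x) : κ(f x)]` of a formal combination of points relative to `f`. -/
def cycleDegree (f : X ⟶ Y) : (X →₀ ℤ) →+ ℤ :=
  Finsupp.liftAddHom fun x => AddMonoidHom.mulLeft (f.residueDegree x : ℤ)

@[simp]
theorem cycleMap_single (f : X ⟶ Y) (x : X) (n : ℤ) :
    cycleMap f (Finsupp.single x n) = Finsupp.single (f x) (f.residueDegree x * n) := by
  simp [cycleMap]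

@[simp]
theorem cycleDegree_single (f : X ⟶ Y) (x : X) (n : ℤ) :
    cycleDegree f (Finsupp.single x n) = f.residueDegree x * n := by
  simp [cycleDegree]

theorem cycleMap_comp (f : X ⟶ Y) (g : Y ⟶ Z) (z : X →₀ ℤ) :
    cycleMap (f ≫ g) z = cycleMap g (cycleMap f z) := by
  induction z using Finsupp.induction_linear with
  | zero => simp
  | add a b ha hb => simp [ha, hb]
  | single x n =>
    rw [cycleMap_single, cycleMap_single, cycleMap_single, residueDegree_comp, Nat.cast_mul,
      mul_assoc]
    rfl

theorem cycleDegree_comp (f : X ⟶ Y) (g : Y ⟶ Z) (z : X →₀ ℤ) :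
    cycleDegree (f ≫ g) z = cycleDegree g (cycleMap f z) := by
  induction z using Finsupp.induction_linear with
  | zero => simp
  | add a b ha hb => simp [ha, hb]
  | single x n =>
    rw [cycleDegree_single, cycleMap_single, cycleDegree_single, residueDegree_comp, Nat.cast_mul,
      mul_assoc]

/-- If `f` contracts everything to the point `p`, push-forward is the degree times `[p]`. -/
theorem cycleMap_eq_single (f : X ⟶ Y) {p : Y} (hp : ∀ x, f x = p) (z : X →₀ ℤ) :
    cycleMap f z = Finsupp.single p (cycleDegree f z) := by
  induction z using Finsupp.induction_linear with
  | zero => simp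
  | add a b ha hb => simp [ha, hb]
  | single x n => simp [hp]

/-- A zero-cycle on the complement of `|D|`, viewed as a formal combination of points of `X`. This
forgets the divisor, so that push-forwards for different divisors can be compared. -/
def toCycle {D : X.IdealSheafData} : ZeroCycle X D →+ (X →₀ ℤ) :=
  Finsupp.mapDomain.addMonoidHom Subtype.val

theorem toCycle_injective {D : X.IdealSheafData} :
    Function.Injective (toCycle : ZeroCycle X D →+ (X →₀ ℤ)) :=
  Finsupp.mapDomain_injective Subtype.val_injective

@[simp]
theorem toCycle_single {D : X.IdealSheafData} (x : ClosedPointOff X D) (n : ℤ) :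
    toCycle (Finsupp.single x n) = Finsupp.single x.1 n :=
  Finsupp.mapDomain_single

theorem toCycle_pushforward (f : X ⟶ Y) [IsProper f] {D : X.IdealSheafData}
    {E : Y.IdealSheafData} (h : D ≤ E.comap f) (z : ZeroCycle X D) :
    toCycle (pushforward f h z) = cycleMap f (toCycle z) := by
  induction z using Finsupp.induction_linear with
  | zero => simp
  | add a b ha hb => simp [ha, hb]
  | single x n =>
    simp only [pushforward, Finsupp.liftAddHom_apply_single, AddMonoidHom.comp_apply,
      AddMonoidHom.coe_mulLeft, Finsupp.singleAddHom_apply, toCycle_single, cycleMap_single]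
    rfl

theorem degree_eq_cycleDegree {k : Type u} [Field k] (π : X ⟶ Spec (.of k))
    (D : X.IdealSheafData) (z : ZeroCycle X D) : degree π D z = cycleDegree π (toCycle z) := by
  induction z using Finsupp.induction_linear with
  | zero => simp
  | add a b ha hb => simp [ha, hb]
  | single x n => simp [degree]

end Cycles

/-! ### Principal divisors on curves -/

section Curves

variable (C : Scheme.{u}) [IsIntegral C]

theorem coheight_le_topologicalKrullDim {X : Scheme.{u}} (x : X) :
    (Order.coheight x : WithBot ℕ∞) ≤ topologicalKrullDim X := by
  rw [topologicalKrullDim, Order.krullDim_eq_of_orderIso (irreducibleSetEquivPoints (α := X))]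
  exact Order.coheight_le_krullDim x

/-- On a scheme of dimension at most one, points of codimension one are closed. -/
theorem isClosed_singleton_of_coheight_eq_one {X : Scheme.{u}} (hX : topologicalKrullDim X ≤ 1)
    {x : X} (hx : Order.coheight x = 1) : IsClosed ({x} : Set X) := by
  rw [← closure_subset_iff_isClosed]
  intro y hy
  by_contra hne
  have hsp : x ⤳ y := specializes_iff_mem_closure.mpr hy
  have hlt : y < x := ⟨hsp, fun h => hne (hsp.antisymm (Scheme.le_iff_specializes.mp h)).eq.symm⟩
  have h1 := Order.coheight_add_one_le hlt
  have h2 := (coheight_le_topologicalKrullDim y).trans hX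
  rw [hx] at h1
  have h3 : Order.coheight y ≤ 1 := by exact_mod_cast h2
  exact absurd (h1.trans h3) (by decide)

variable {C} in
theorem ne_genericPoint_of_isClosed (hC : topologicalKrullDim C = 1) {x : C}
    (hx : IsClosed ({x} : Set C)) : x ≠ genericPoint C := by
  rintro rfl
  have h : ∀ y : C, y = genericPoint C := fun y => by
    have := (genericPoint_specializes y).mem_closed hx rfl
    simpa using this
  have : Subsingleton C := ⟨fun a b => (h a).trans (h b).symm⟩
  have := topologicalKrullDim_zero_of_discreteTopology C
  rw [hC] at this
  exact absurd this (by decide)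

variable {C} in
theorem coheight_eq_one_of_isClosed (hC : topologicalKrullDim C = 1) {x : C}
    (hx : IsClosed ({x} : Set C)) : Order.coheight x = 1 := by
  apply le_antisymm
  · have := (coheight_le_topologicalKrullDim x).trans hC.le
    exact_mod_cast this
  · have hne := ne_genericPoint_of_isClosed hC hx
    have hlt : x < genericPoint C := ⟨genericPoint_specializes x, fun h =>
      hne ((genericPoint_specializes x).antisymm (Scheme.le_iff_specializes.mp h)).eq.symm⟩
    exact le_trans (by simp) (Order.coheight_add_one_le hlt)

variable {C} in
theorem isClosed_singleton_of_ne_genericPoint (hC : topologicalKrullDim C = 1) {x : C}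
    (hx : x ≠ genericPoint C) : IsClosed ({x} : Set C) := by
  apply isClosed_singleton_of_coheight_eq_one hC.le
  apply le_antisymm
  · have := (coheight_le_topologicalKrullDim x).trans hC.le
    exact_mod_cast this
  · have hlt : x < genericPoint C := ⟨genericPoint_specializes x, fun h =>
      hx ((genericPoint_specializes x).antisymm (Scheme.le_iff_specializes.mp h)).eq.symm⟩
    exact le_trans (by simp) (Order.coheight_add_one_le hlt)

/-- The divisor `∑ ord_x(f) [x]` of a rational function, with no modulus imposed. -/
def principalCycle [IsNoetherian C] (f : C.functionField) : C →₀ ℤ :=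
  Finsupp.ofSupportFinite (fun x => Scheme.ord f x) (finite_ord_ne_zero C f)

variable {C}

@[simp]
theorem principalCycle_apply [IsNoetherian C] (f : C.functionField) (x : C) :
    principalCycle C f x = Scheme.ord f x := rfl

theorem principalCycle_mul [IsNoetherian C] {f g : C.functionField} (hf : f ≠ 0) (hg : g ≠ 0) :
    principalCycle C (f * g) = principalCycle C f + principalCycle C g := by
  ext x
  simp [Scheme.ord_mul hf hg]

/-- A function invertible in the local ring at `x` has order zero at `x`. Off codimension one this
is the convention that the order vanishes there. -/
theorem ord_algebraMap_unit [IsLocallyNoetherian C] {x : C} {a : C.presheaf.stalk x}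
    (ha : IsUnit a) : Scheme.ord (algebraMap _ C.functionField a) x = 0 := by
  by_cases hx : Order.coheight x = 1
  · have : Ring.KrullDimLE 1 (C.presheaf.stalk x) := krullDimLE_of_coheight_le hx.le
    rw [Scheme.ord_eq_iff hx ((ha.map _).ne_zero)]
    exact Ring.ordFrac_of_isUnit ha
  · exact Scheme.ord_eq_zero_of_coheight_neq_one hx _

/-- The condition that `f` be a unit at `i z` whose restriction along `i` is `1` at `z`. -/
def IsOneAlong {Z : Scheme.{u}} (i : Z ⟶ C) (f : (C.functionField : Type u)ˣ) (z : Z) : Prop :=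
  f ∈ (Units.map (i.stalkMap z).hom.toMonoidHom).ker.map
      (Units.map (algebraMap (C.presheaf.stalk (i z)) C.functionField).toMonoidHom)

theorem mem_modulusGroup_iff {E : C.IdealSheafData} {f : (C.functionField : Type u)ˣ} :
    f ∈ modulusGroup C E ↔ ∀ z, IsOneAlong E.subschemeι f z := by
  simp only [modulusGroup, Subgroup.mem_iInf]
  rfl

theorem IsOneAlong.comp {Z Z' : Scheme.{u}} (j : Z' ⟶ Z) {i : Z ⟶ C}
    {f : (C.functionField : Type u)ˣ} {z : Z'} (h : IsOneAlong i f (j z)) :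
    IsOneAlong (j ≫ i) f z := by
  obtain ⟨u, hu, hf⟩ := h
  refine ⟨u, ?_, hf⟩
  have h1 : (i.stalkMap (j z)).hom u.1 = 1 := congrArg Units.val (MonoidHom.mem_ker.mp hu)
  refine MonoidHom.mem_ker.mpr (Units.ext ?_)
  change ((j ≫ i).stalkMap z).hom u.1 = 1
  rw [Scheme.Hom.stalkMap_comp]
  change (j.stalkMap z).hom ((i.stalkMap (j z)).hom u.1) = 1
  rw [h1, map_one]

/-- A larger divisor imposes a stronger modulus condition; larger divisors have smaller ideals. -/
theorem modulusGroup_mono {E E' : C.IdealSheafData} (h : E' ≤ E) :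
    modulusGroup C E' ≤ modulusGroup C E := by
  intro f hf
  rw [mem_modulusGroup_iff] at hf ⊢
  intro z
  rw [← Scheme.IdealSheafData.inclusion_subschemeι h]
  exact (hf _).comp _

theorem ord_eq_zero_of_mem_modulusGroup [IsLocallyNoetherian C] {E : C.IdealSheafData}
    {f : (C.functionField : Type u)ˣ} (hf : f ∈ modulusGroup C E) {x : C} (hx : x ∈ E.support) :
    Scheme.ord (f : C.functionField) x = 0 := by
  rw [mem_modulusGroup_iff] at hf
  have hx' : x ∈ Set.range E.subschemeι := by
    rw [Scheme.IdealSheafData.range_subschemeι]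
    exact hx
  obtain ⟨z, rfl⟩ := hx'
  obtain ⟨u, -, rfl⟩ := hf z
  exact ord_algebraMap_unit u.isUnit

/-- For a rational function satisfying the modulus condition on a curve, removing the points on
the divisor loses nothing. -/
theorem toCycle_divisor [IsNoetherian C] (hC : topologicalKrullDim C ≤ 1) {E : C.IdealSheafData}
    {f : (C.functionField : Type u)ˣ} (hf : f ∈ modulusGroup C E) :
    toCycle (divisor C E (f : C.functionField)) = principalCycle C f := by
  ext x
  by_cases hx : IsClosed ({x} : Set C) ∧ x ∉ E.support
  · exact Finsupp.mapDomain_apply Subtype.val_injective (divisor C E (f : C.functionField)) ⟨x, hx⟩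
  · have h1 : toCycle (divisor C E (f : C.functionField)) x = 0 :=
      Finsupp.mapDomain_of_notMem_range _ _ (by rintro ⟨y, rfl⟩; exact hx y.2)
    rw [h1, principalCycle_apply]
    by_cases hxE : x ∈ E.support
    · exact (ord_eq_zero_of_mem_modulusGroup hf hxE).symm
    · by_contra h0
      have hco : Order.coheight x = 1 := by
        by_contra h
        exact h0 (Scheme.ord_eq_zero_of_coheight_neq_one h _).symm
      exact hx ⟨isClosed_singleton_of_coheight_eq_one hC hco, hxE⟩

/-- The generators of the relations, computed without reference to the divisor. -/
theorem toCycle_tau {X : Scheme.{u}} {D : X.IdealSheafData} (W : FiniteCurve X D)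
    {f : (W.C.functionField : Type u)ˣ} (hf : f ∈ modulusGroup W.C (D.comap W.φ)) :
    toCycle (W.tau (f : W.C.functionField)) = cycleMap W.φ (principalCycle W.C f) := by
  rw [FiniteCurve.tau, toCycle_pushforward, toCycle_divisor W.dim_eq_one.le hf]

theorem tau_mem_modulusRelations {X : Scheme.{u}} {D : X.IdealSheafData} (W : FiniteCurve X D)
    {f : (W.C.functionField : Type u)ˣ} (hf : f ∈ modulusGroup W.C (D.comap W.φ)) :
    W.tau (f : W.C.functionField) ∈ modulusRelations X D :=
  AddSubgroup.subset_closure ⟨W, f, hf, rfl⟩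

/-- The defining relations are preserved by push-forward as long as the curve stays finite over
the target. -/
theorem pushforward_tau_mem {X X' : Scheme.{u}} (g : X' ⟶ X) [IsProper g]
    {D' : X'.IdealSheafData} {D : X.IdealSheafData} (h : D' ≤ D.comap g) (W : FiniteCurve X' D')
    [IsFinite (W.φ ≫ g)] {f : (W.C.functionField : Type u)ˣ}
    (hf : f ∈ modulusGroup W.C (D'.comap W.φ)) :
    pushforward g h (W.tau (f : W.C.functionField)) ∈ modulusRelations X D := by
  let W' : FiniteCurve X D :=
    { C := W.C
      φ := W.φ ≫ g
      isIntegral := inferInstance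
      isNoetherian := inferInstance
      normal := W.normal
      dim_eq_one := W.dim_eq_one
      isFinite := inferInstance
      not_subset := by
        intro hsub
        refine W.not_subset ?_
        rintro _ ⟨c, rfl⟩
        refine Scheme.IdealSheafData.support_antitone h ?_
        rw [Scheme.IdealSheafData.support_comap]
        exact hsub ⟨c, rfl⟩ }
  have hf' : f ∈ modulusGroup W'.C (D.comap W'.φ) := by
    refine modulusGroup_mono ?_ hf
    change D'.comap W.φ ≤ D.comap (W.φ ≫ g)
    rw [Scheme.IdealSheafData.comap_comp]
    exact Scheme.IdealSheafData.comap_mono W.φ h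
  have h1 : pushforward g h (W.tau (f : W.C.functionField)) = W'.tau (f : W.C.functionField) := by
    apply toCycle_injective
    rw [toCycle_pushforward, toCycle_tau W hf]
    refine Eq.trans ?_ (toCycle_tau W' hf').symm
    exact (cycleMap_comp W.φ g _).symm
  rw [h1]
  exact tau_mem_modulusRelations W' hf'

/-- To see that push-forward respects the relations it suffices to look at the generators. -/
theorem pushforward_mem_of_forall {X X' : Scheme.{u}} (g : X' ⟶ X) [IsProper g]
    {D' : X'.IdealSheafData} {D : X.IdealSheafData} (h : D' ≤ D.comap g)
    (H : ∀ (W : FiniteCurve X' D') (f : (W.C.functionField : Type u)ˣ),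
      f ∈ modulusGroup W.C (D'.comap W.φ) →
      pushforward g h (W.tau (f : W.C.functionField)) ∈ modulusRelations X D)
    {z : ZeroCycle X' D'} (hz : z ∈ modulusRelations X' D') :
    pushforward g h z ∈ modulusRelations X D := by
  have : modulusRelations X' D' ≤ (modulusRelations X D).comap (pushforward g h) := by
    rw [modulusRelations, AddSubgroup.closure_le]
    rintro _ ⟨W, f, hf, rfl⟩
    exact H W f hf
  exact this hz

/-- Push-forward along a finite morphism preserves the defining relations. -/
theorem pushforward_mem_of_isFinite {X X' : Scheme.{u}} (g : X' ⟶ X) [IsFinite g]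
    {D' : X'.IdealSheafData} {D : X.IdealSheafData} (h : D' ≤ D.comap g)
    {z : ZeroCycle X' D'} (hz : z ∈ modulusRelations X' D') :
    pushforward g h z ∈ modulusRelations X D :=
  pushforward_mem_of_forall g h (fun W _ hf => pushforward_tau_mem g h W hf) hz

end Curves

/-! ### Pull-back of a product of ideal sheaves -/

section Comap

variable {X Y : Scheme.{u}}

open Scheme.IdealSheafData in
/-- Away from the support of `A`, multiplying by `A` changes nothing. -/
theorem comap_mul_of_comap_eq_top {A : Y.IdealSheafData} (B : Y.IdealSheafData) (f : X ⟶ Y)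
    (hA : A.comap f = ⊤) : (A * B).comap f = B.comap f := by
  let U : Y.Opens := A.support.compl
  have hr : Set.range f ⊆ Set.range U.ι := by
    rintro _ ⟨x, rfl⟩
    rw [Scheme.Opens.range_ι]
    intro hx
    have h1 : x ∈ (A.comap f).support := by
      rw [support_comap]
      exact hx
    rw [hA, support_top] at h1
    exact h1
  rw [← IsOpenImmersion.lift_fac U.ι f hr, comap_comp, comap_comp]
  congr 1
  have hU : A.comap U.ι = ⊤ := by
    rw [← support_eq_bot_iff, support_comap]
    ext x
    simp only [TopologicalSpace.Closeds.coe_preimage, Set.mem_preimage, SetLike.mem_coe,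
      TopologicalSpace.Closeds.coe_bot, Set.mem_empty_iff_false, iff_false]
    exact x.2
  ext V : 2
  have h1 : (1 : Γ(U, V)) ∈ (A.comap U.ι).ideal V := by
    rw [hU]
    trivial
  rw [ideal_comap_of_isOpenImmersion, Ideal.mem_comap, map_one, ← Ideal.eq_top_iff_one] at h1
  rw [ideal_comap_of_isOpenImmersion, ideal_comap_of_isOpenImmersion]
  simp only [ideal_mul, Pi.mul_apply, h1]
  rw [Ideal.top_mul]

theorem comap_eq_top_iff {A : Y.IdealSheafData} {f : X ⟶ Y} :
    A.comap f = ⊤ ↔ ∀ x, f x ∉ A.support := by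
  rw [← Scheme.IdealSheafData.support_eq_bot_iff, Scheme.IdealSheafData.support_comap,
    SetLike.ext_iff]
  exact forall_congr' fun x => iff_false_right (Set.notMem_empty x)

end Comap

/-! ### Curves over a base: contracted or finite -/

section CurveMaps

theorem finite_of_isClosed_of_genericPoint_notMem {C : Scheme.{u}} [IsIntegral C] [IsNoetherian C]
    (hC : topologicalKrullDim C = 1) {S : Set C} (hS : IsClosed S) (hη : genericPoint C ∉ S) :
    S.Finite := by
  obtain ⟨T, hTf, hTc, hTi, rfl⟩ :=
    TopologicalSpace.NoetherianSpace.exists_finite_set_isClosed_irreducible hS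
  refine Set.Finite.sUnion hTf fun t ht => ?_
  obtain ⟨x, hx⟩ := QuasiSober.sober (hTi t ht) (hTc t ht)
  have hxη : x ≠ genericPoint C := by
    rintro rfl
    exact hη ⟨t, ht, hx.mem⟩
  have := isClosed_singleton_of_ne_genericPoint hC hxη
  rw [← hx.def, this.closure_eq]
  exact Set.finite_singleton x

/-- A proper morphism from a curve that does not contract the curve to a closed point is finite. -/
theorem isFinite_of_not_contracted {C X : Scheme.{u}} [IsIntegral C] [IsNoetherian C]
    (hC : topologicalKrullDim C = 1) (g : C ⟶ X) [IsProper g]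
    (h : ¬ ∃ x : X, IsClosed ({x} : Set X) ∧ ∀ c, g c = x) : IsFinite g := by
  -- proper and quasi-finite implies finite; the fibres over closed points are proper closed subsets
  -- of the curve, and those over other points contain at most the generic point
  have : LocallyQuasiFinite g := by
    refine LocallyQuasiFinite.of_finite_preimage_singleton g fun x => ?_
    by_cases hx : IsClosed ({x} : Set X)
    · refine finite_of_isClosed_of_genericPoint_notMem hC (hx.preimage g.continuous) fun hη => ?_
      refine h ⟨x, hx, fun c => ?_⟩
      exact ((genericPoint_specializes c).map g.continuous).mem_closed hx hη
    · refine (Set.finite_singleton (genericPoint C)).subset fun c hc => ?_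
      by_contra hne
      have hcl := g.isClosedMap _ (isClosed_singleton_of_ne_genericPoint hC hne)
      have hc' : g c = x := hc
      rw [Set.image_singleton, hc'] at hcl
      exact hx hcl
  exact IsFinite.of_isProper_of_locallyQuasiFinite g

/-- A morphism from a reduced scheme whose image lies in a closed subscheme factors through it. -/
theorem exists_lift_of_range_subset {C X Z : Scheme.{u}} [IsReduced C] (i : Z ⟶ X)
    [IsClosedImmersion i] (g : C ⟶ X) (h : Set.range g ⊆ Set.range i) :
    ∃ l : C ⟶ Z, l ≫ i = g := by
  -- the preimage of the closed subscheme is all of `C` as a set, hence as a scheme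
  have h0 : i.ker.comap g = ⊥ := by
    rw [← Scheme.IdealSheafData.support_eq_top_iff, Scheme.IdealSheafData.support_comap]
    ext c
    exact ⟨fun _ => trivial, fun _ => i.range_subset_ker_support (h ⟨c, rfl⟩)⟩
  have hk : i.ker ≤ g.ker :=
    (Scheme.IdealSheafData.le_map_iff_comap_le.mpr h0.le).trans
      (Scheme.IdealSheafData.map_bot g).le
  exact ⟨IsClosedImmersion.lift i g hk, IsClosedImmersion.lift_fac i g hk⟩

end CurveMaps

/-! ### The fibre of the first projection over a closed point -/

section Fibre

variable {k : Type u} [Field k] {X Y : Scheme.{u}} (πX : X ⟶ Spec (.of k)) (πY : Y ⟶ Spec (.of k))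
  {K : Type u} [Field K] [Algebra k K] {i : Spec (.of K) ⟶ X}
  (hi : i ≫ πX = Spec.map (CommRingCat.ofHom (algebraMap k K)))

/-- The inclusion `Y_K ⟶ X × Y` of the fibre of the first projection over a point
`i : Spec K ⟶ X`. -/
def fibreMap : baseChange πY K ⟶ pullback πX πY :=
  pullback.lift (baseChangeStr πY K ≫ i) (pullback.fst _ _) (by
    rw [Category.assoc, hi, pullback.condition])

@[simp]
theorem fibreMap_fst : fibreMap πX πY hi ≫ pullback.fst πX πY = baseChangeStr πY K ≫ i :=
  pullback.lift_fst _ _ _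

@[simp]
theorem fibreMap_snd : fibreMap πX πY hi ≫ pullback.snd πX πY = pullback.fst _ _ :=
  pullback.lift_snd _ _ _

theorem isPullback_fibreMap :
    IsPullback (fibreMap πX πY hi) (baseChangeStr πY K) (pullback.fst πX πY) i := by
  refine IsPullback.of_right (h₁₂ := pullback.snd πX πY) (v₁₃ := πY) (h₂₂ := πX) ?_
    (fibreMap_fst πX πY hi) (IsPullback.of_hasPullback πX πY).flip
  rw [fibreMap_snd, hi]
  exact IsPullback.of_hasPullback _ _

instance isClosedImmersion_fibreMap [IsClosedImmersion i] :
    IsClosedImmersion (fibreMap πX πY hi) :=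
  MorphismProperty.of_isPullback (isPullback_fibreMap πX πY hi).flip ‹_›

theorem exists_fibreMap_eq (z : ↥(pullback πX πY)) (t : Spec (.of K))
    (hz : pullback.fst πX πY z = i t) : ∃ z', fibreMap πX πY hi z' = z := by
  obtain ⟨w, hw, -⟩ := Scheme.Pullback.exists_preimage_pullback z t hz
  refine ⟨(isPullback_fibreMap πX πY hi).isoPullback.inv w, ?_⟩
  rw [← Scheme.Hom.comp_apply, IsPullback.isoPullback_inv_fst, hw]

/-- On the fibre over a point off `|D|` the component `D × Y` is invisible, and the product divisor
restricts to the base change of `E`. -/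
theorem prodDivisor_comap_fibreMap {D : X.IdealSheafData} (E : Y.IdealSheafData)
    (hD : D.comap i = ⊤) :
    (prodDivisor πX πY D E).comap (fibreMap πX πY hi) = baseChangeDivisor πY K E := by
  rw [prodDivisor, mul_comm, comap_mul_of_comap_eq_top, ← Scheme.IdealSheafData.comap_comp,
    fibreMap_snd]
  rw [← Scheme.IdealSheafData.comap_comp, fibreMap_fst, Scheme.IdealSheafData.comap_comp, hD,
    Scheme.IdealSheafData.comap_top]

end Fibre

/-! ### The section defined by a rational point -/

section Section

variable {k : Type u} [Field k] {X Y : Scheme.{u}} (πX : X ⟶ Spec (.of k)) (πY : Y ⟶ Spec (.of k))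
  {y : Spec (.of k) ⟶ Y} (hy : y ≫ πY = 𝟙 _)

/-- The section `x ↦ (x, y)` of the first projection. -/
def sectionMap : X ⟶ pullback πX πY :=
  pullback.lift (𝟙 X) (πX ≫ y) (by rw [Category.assoc, hy, Category.id_comp, Category.comp_id])

@[simp]
theorem sectionMap_fst : sectionMap πX πY hy ≫ pullback.fst πX πY = 𝟙 X :=
  pullback.lift_fst _ _ _

@[simp]
theorem sectionMap_snd : sectionMap πX πY hy ≫ pullback.snd πX πY = πX ≫ y :=
  pullback.lift_snd _ _ _

instance isClosedImmersion_sectionMap [IsSeparated πY] :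
    IsClosedImmersion (sectionMap πX πY hy) := by
  have : IsClosedImmersion (sectionMap πX πY hy ≫ pullback.fst πX πY) := by
    rw [sectionMap_fst]
    infer_instance
  exact IsClosedImmersion.of_comp _ (pullback.fst πX πY)

/-- The section misses `X × E`, so the product divisor restricts to `D` along it. -/
theorem prodDivisor_comap_sectionMap (D : X.IdealSheafData) {E : Y.IdealSheafData}
    (hE : ∀ t, y t ∉ E.support) : (prodDivisor πX πY D E).comap (sectionMap πX πY hy) = D := by
  rw [prodDivisor, comap_mul_of_comap_eq_top, ← Scheme.IdealSheafData.comap_comp,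
    sectionMap_fst, Scheme.IdealSheafData.comap_id]
  rw [← Scheme.IdealSheafData.comap_comp, sectionMap_snd, Scheme.IdealSheafData.comap_comp,
    comap_eq_top_iff.mpr hE, Scheme.IdealSheafData.comap_top]

end Section

/-! ### Push-forward along the first projection -/

/-- Relative degrees do not change when the target is embedded in a larger scheme. -/
theorem cycleDegree_comp_of_surjectiveOnStalks {X Y Z : Scheme.{u}} (f : X ⟶ Y) (i : Y ⟶ Z)
    [SurjectiveOnStalks i] (z : X →₀ ℤ) : cycleDegree (f ≫ i) z = cycleDegree f z := by
  induction z using Finsupp.induction_linear with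
  | zero => simp
  | add a b ha hb => simp [ha, hb]
  | single x n => simp [residueDegree_comp, residueDegree_eq_one i]

/-- A closed point of a scheme locally of finite type over `k` is the image of a closed immersion
of the spectrum of a finite extension of `k`. -/
theorem exists_closedPoint_immersion {k : Type u} [Field k] {X : Scheme.{u}}
    (πX : X ⟶ Spec (.of k)) [LocallyOfFiniteType πX] {x : X} (hx : IsClosed ({x} : Set X)) :
    ∃ (K : Type u) (_ : Field K) (_ : Algebra k K) (_ : FiniteDimensional k K)
      (i : Spec (.of K) ⟶ X), IsClosedImmersion i ∧
      i ≫ πX = Spec.map (CommRingCat.ofHom (algebraMap k K)) ∧ ∀ t, i t = x := by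
  have hi : IsClosedImmersion (X.fromSpecResidueField x) :=
    isClosed_singleton_iff_isClosedImmersion.mp hx
  obtain ⟨ψ, hψ⟩ := Spec.map_surjective (X.fromSpecResidueField x ≫ πX)
  let : Algebra k (X.residueField x) := ψ.hom.toAlgebra
  have hfin : IsFinite (X.fromSpecResidueField x ≫ πX) :=
    isFinite_iff_locallyOfFiniteType_of_jacobsonSpace.mpr inferInstance
  rw [← hψ, IsFinite.SpecMap_iff] at hfin
  exact ⟨X.residueField x, inferInstance, inferInstance, hfin, X.fromSpecResidueField x, hi,
    hψ.symm, fun t => X.fromSpecResidueField_apply x t⟩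

section Projection

variable {k : Type u} [Field k] {X Y : Scheme.{u}} (πX : X ⟶ Spec (.of k)) (πY : Y ⟶ Spec (.of k))
  [IsProper πX] [IsProper πY] {D : X.IdealSheafData} {E : Y.IdealSheafData}

omit [IsProper πX] [IsProper πY] in
theorem notMem_support_of_prodDivisor {z : ↥(pullback πX πY)}
    (hz : z ∉ (prodDivisor πX πY D E).support) : pullback.fst πX πY z ∉ D.support := fun h =>
  hz (Scheme.IdealSheafData.support_antitone (prodDivisor_le πX πY D E) (by
    rw [Scheme.IdealSheafData.support_comap]
    exact h))

/-- A relation carried by a curve in a fibre of the first projection has push-forward zero: it is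
a relation on that fibre, so its degree vanishes by hypothesis. -/
theorem pushforward_tau_eq_zero_of_contracted
    (hdeg : ∀ (K : Type u) [Field K] [Algebra k K] [FiniteDimensional k K],
      DegreeInducesIso (baseChangeStr πY K) (baseChangeDivisor πY K E))
    (W : FiniteCurve (pullback πX πY) (prodDivisor πX πY D E))
    {f : (W.C.functionField : Type u)ˣ}
    (hf : f ∈ modulusGroup W.C ((prodDivisor πX πY D E).comap W.φ))
    {x : X} (hx : IsClosed ({x} : Set X)) (hW : ∀ c, (W.φ ≫ pullback.fst πX πY) c = x) :
    pushforward (pullback.fst πX πY) (prodDivisor_le πX πY D E)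
      (W.tau (f : W.C.functionField)) = 0 := by
  obtain ⟨K, _, _, _, i, hicl, hi, hix⟩ := exists_closedPoint_immersion πX hx
  obtain ⟨l, hl⟩ := exists_lift_of_range_subset i (W.φ ≫ pullback.fst πX πY) (by
    rintro _ ⟨c, rfl⟩
    rw [hW c]
    exact ⟨IsLocalRing.closedPoint K, hix _⟩)
  -- the curve lies in the fibre `Y_K` over `x`, where it is again an admissible curve
  let ψ : W.C ⟶ baseChange πY K := (isPullback_fibreMap πX πY hi).lift W.φ l hl.symm
  have hψ : ψ ≫ fibreMap πX πY hi = W.φ := (isPullback_fibreMap πX πY hi).lift_fst _ _ _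
  have hψ' : ψ ≫ baseChangeStr πY K = l := (isPullback_fibreMap πX πY hi).lift_snd _ _ _
  have : IsFinite (ψ ≫ fibreMap πX πY hi) := by
    rw [hψ]
    infer_instance
  have hfin : IsFinite ψ := .of_comp ψ (fibreMap πX πY hi)
  have hxD : x ∉ D.support := by
    obtain ⟨c, hc⟩ : ∃ c, W.φ c ∉ (prodDivisor πX πY D E).support := by
      by_contra! h
      exact W.not_subset (by rintro _ ⟨c, rfl⟩; exact h c)
    rw [← hW c]
    exact notMem_support_of_prodDivisor πX πY hc
  have hD' : (prodDivisor πX πY D E).comap (fibreMap πX πY hi) = baseChangeDivisor πY K E :=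
    prodDivisor_comap_fibreMap πX πY hi E (comap_eq_top_iff.mpr fun t => by rwa [hix])
  let W' : FiniteCurve (baseChange πY K) (baseChangeDivisor πY K E) :=
    { C := W.C
      φ := ψ
      isIntegral := inferInstance
      isNoetherian := inferInstance
      normal := W.normal
      dim_eq_one := W.dim_eq_one
      isFinite := hfin
      not_subset := by
        intro hsub
        refine W.not_subset ?_
        rintro _ ⟨c, rfl⟩
        have h1 : ψ c ∈ (baseChangeDivisor πY K E).support := hsub ⟨c, rfl⟩
        rw [← hD', Scheme.IdealSheafData.support_comap] at h1
        rw [← hψ]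
        exact h1 }
  have hf' : f ∈ modulusGroup W'.C ((baseChangeDivisor πY K E).comap W'.φ) := by
    refine modulusGroup_mono (le_of_eq ?_) hf
    change _ = (baseChangeDivisor πY K E).comap ψ
    rw [← hD', ← Scheme.IdealSheafData.comap_comp, hψ]
  have hzero : cycleDegree (baseChangeStr πY K) (cycleMap ψ (principalCycle W.C f)) = 0 := by
    obtain ⟨e, he⟩ := hdeg K
    have h1 := he (W'.tau (f : W.C.functionField))
    have h0 : CH0.mk (W'.tau (f : W.C.functionField)) = 0 :=
      (QuotientAddGroup.eq_zero_iff _).mpr (tau_mem_modulusRelations W' hf')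
    rw [h0, map_zero, degree_eq_cycleDegree, toCycle_tau W' hf'] at h1
    exact h1.symm
  apply toCycle_injective
  rw [toCycle_pushforward, toCycle_tau W hf, ← cycleMap_comp, cycleMap_eq_single _ hW, ← hl,
    cycleDegree_comp_of_surjectiveOnStalks, ← hψ', cycleDegree_comp, hzero]
  simp

/-- If the degree is an isomorphism on all fibres, every closed point of the product is rationally
equivalent to a zero-cycle on the section. -/
theorem exists_mk_eq_mk_pushforward_sectionMap
    (hdeg : ∀ (K : Type u) [Field K] [Algebra k K] [FiniteDimensional k K],
      DegreeInducesIso (baseChangeStr πY K) (baseChangeDivisor πY K E))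
    {y : Spec (.of k) ⟶ Y} (hy : y ≫ πY = 𝟙 _) (hyE : ∀ t, y t ∉ E.support)
    (h : D ≤ (prodDivisor πX πY D E).comap (sectionMap πX πY hy))
    (z : ClosedPointOff (pullback πX πY) (prodDivisor πX πY D E)) :
    ∃ w : ZeroCycle X D, Finsupp.single z 1 - pushforward (sectionMap πX πY hy) h w ∈
      modulusRelations (pullback πX πY) (prodDivisor πX πY D E) := by
  let x := z.map (pullback.fst πX πY) (prodDivisor_le πX πY D E)
  obtain ⟨K, _, _, _, i, hicl, hi, hix⟩ := exists_closedPoint_immersion πX x.2.1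
  have hD' : (prodDivisor πX πY D E).comap (fibreMap πX πY hi) = baseChangeDivisor πY K E :=
    prodDivisor_comap_fibreMap πX πY hi E (comap_eq_top_iff.mpr fun t => by
      rw [hix]
      exact x.2.2)
  obtain ⟨z', hz'⟩ := exists_fibreMap_eq πX πY hi z.1 (IsLocalRing.closedPoint K) (hix _).symm
  have hz'cl : IsClosed ({z'} : Set ↥(baseChange πY K)) := by
    have h1 := z.2.1.preimage (fibreMap πX πY hi).continuous
    rw [← hz', ← Set.image_singleton,
      Set.preimage_image_eq _ (fibreMap πX πY hi).isClosedEmbedding.injective] at h1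
    exact h1
  have hz'E : z' ∉ (baseChangeDivisor πY K E).support := by
    rw [← hD', Scheme.IdealSheafData.support_comap]
    intro h1
    refine z.2.2 ?_
    rw [← hz']
    exact h1
  let ζ : ClosedPointOff (baseChange πY K) (baseChangeDivisor πY K E) := ⟨z', hz'cl, hz'E⟩
  -- the rational point of the fibre defined by `y`
  let yK : Spec (.of K) ⟶ baseChange πY K :=
    pullback.lift (Spec.map (CommRingCat.ofHom (algebraMap k K)) ≫ y) (𝟙 _) (by
      rw [Category.assoc, hy, Category.comp_id, Category.id_comp])
  have hyK : yK ≫ baseChangeStr πY K = 𝟙 _ := pullback.lift_snd _ _ _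
  have hyK' : yK ≫ pullback.fst _ _ = Spec.map (CommRingCat.ofHom (algebraMap k K)) ≫ y :=
    pullback.lift_fst _ _ _
  have hyKcl : IsClosedImmersion yK := isClosedImmersion_of_comp_eq_id _ _ hyK
  let pt : Spec (.of K) := IsLocalRing.closedPoint K
  let υ : ClosedPointOff (baseChange πY K) (baseChangeDivisor πY K E) :=
    ⟨yK pt, by
      have h1 := yK.isClosedMap _ (IsLocalRing.isClosed_singleton_closedPoint K)
      have h2 : yK '' {pt} = {yK pt} := Set.image_singleton
      exact h2 ▸ h1, by
      rw [baseChangeDivisor, Scheme.IdealSheafData.support_comap]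
      intro h1
      have h2 : (yK ≫ pullback.fst _ _) pt ∈ E.support := h1
      rw [hyK'] at h2
      exact hyE _ h2⟩
  have hdυ : (baseChangeStr πY K).residueDegree (yK pt) = 1 := by
    have h1 := residueDegree_comp yK (baseChangeStr πY K) pt
    rw [hyK, Scheme.Hom.residueDegree_id, residueDegree_eq_one yK, mul_one] at h1
    exact h1.symm
  -- `z'` and `d [y_K]` have the same degree, hence the same class on the fibre
  set d : ℤ := ((baseChangeStr πY K).residueDegree z' : ℤ) with hd
  have hrel : Finsupp.single ζ 1 - Finsupp.single υ d ∈
      modulusRelations (baseChange πY K) (baseChangeDivisor πY K E) := by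
    obtain ⟨e, he⟩ := hdeg K
    rw [← QuotientAddGroup.eq_zero_iff]
    apply e.injective
    have h1 := he (Finsupp.single ζ 1 - Finsupp.single υ d)
    rw [map_zero]
    refine h1.trans ?_
    rw [degree_eq_cycleDegree, map_sub, toCycle_single, toCycle_single, map_sub,
      cycleDegree_single, cycleDegree_single, hdυ, ← hd]
    simp
  have hle : baseChangeDivisor πY K E ≤ (prodDivisor πX πY D E).comap (fibreMap πX πY hi) :=
    hD'.ge
  have hpush := pushforward_mem_of_isFinite (fibreMap πX πY hi) hle hrel
  refine ⟨Finsupp.single x d, ?_⟩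
  convert hpush using 1
  apply toCycle_injective
  -- the rational point of the fibre over `x` is the value of the section at `x`
  have hs : sectionMap πX πY hy x.1 = fibreMap πX πY hi (yK pt) := by
    rw [← hix pt, ← Scheme.Hom.comp_apply, ← Scheme.Hom.comp_apply]
    have h1 : i ≫ sectionMap πX πY hy = yK ≫ fibreMap πX πY hi := by
      apply pullback.hom_ext
      · rw [Category.assoc, sectionMap_fst, Category.assoc, fibreMap_fst, reassoc_of% hyK,
          Category.comp_id]
      · rw [Category.assoc, sectionMap_snd, Category.assoc, fibreMap_snd, hyK', reassoc_of% hi]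
    rw [h1]
  rw [map_sub, toCycle_pushforward, toCycle_pushforward, map_sub, map_sub, toCycle_single,
    toCycle_single, toCycle_single, toCycle_single, cycleMap_single, cycleMap_single,
    cycleMap_single, residueDegree_eq_one, residueDegree_eq_one, residueDegree_eq_one, hs, hz']
  simp [υ]

/-- If `Y` has a rational point off `E` and the degree is an isomorphism on all base changes of
`Y`, push-forward along the first projection is an isomorphism, with inverse the push-forward
along the section given by the rational point. -/
theorem pushforwardInducesIso_fst_of_degree
    (hdeg : ∀ (K : Type u) [Field K] [Algebra k K] [FiniteDimensional k K],
      DegreeInducesIso (baseChangeStr πY K) (baseChangeDivisor πY K E))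
    {y : Spec (.of k) ⟶ Y} (hy : y ≫ πY = 𝟙 _) (hyE : ∀ t, y t ∉ E.support) :
    PushforwardInducesIso (pullback.fst πX πY) (prodDivisor_le πX πY D E) := by
  have hs : D ≤ (prodDivisor πX πY D E).comap (sectionMap πX πY hy) :=
    (prodDivisor_comap_sectionMap πX πY hy D hyE).ge
  let P : CH0 (pullback πX πY) (prodDivisor πX πY D E) →+ CH0 X D :=
    QuotientAddGroup.map _ _ (pushforward (pullback.fst πX πY) (prodDivisor_le πX πY D E))
      (fun z hz => pushforward_mem_of_forall _ _ (fun W f hf => by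
        by_cases hW : ∃ x : X, IsClosed ({x} : Set X) ∧ ∀ c, (W.φ ≫ pullback.fst πX πY) c = x
        · obtain ⟨x, hx, hW⟩ := hW
          rw [pushforward_tau_eq_zero_of_contracted πX πY hdeg W hf hx hW]
          exact zero_mem _
        · have := isFinite_of_not_contracted W.dim_eq_one (W.φ ≫ pullback.fst πX πY) hW
          exact pushforward_tau_mem _ _ W hf) hz)
  let S : CH0 X D →+ CH0 (pullback πX πY) (prodDivisor πX πY D E) :=
    QuotientAddGroup.map _ _ (pushforward (sectionMap πX πY hy) hs)
      (fun z hz => pushforward_mem_of_isFinite _ hs hz)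
  have hPS (a : CH0 X D) : P (S a) = a := by
    induction a using QuotientAddGroup.induction_on with
    | H z =>
      change CH0.mk (pushforward _ _ (pushforward _ _ z)) = CH0.mk z
      congr 1
      apply toCycle_injective
      rw [toCycle_pushforward, toCycle_pushforward, ← cycleMap_comp, sectionMap_fst]
      induction toCycle z using Finsupp.induction_linear with
      | zero => simp
      | add a b ha hb => simp [ha, hb]
      | single x n =>
        rw [cycleMap_single, Scheme.Hom.residueDegree_id]
        simp
  have hS : Function.Surjective S := by
    rw [← AddMonoidHom.range_eq_top, eq_top_iff]
    rintro a -
    induction a using QuotientAddGroup.induction_on with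
    | H z =>
      change CH0.mk z ∈ S.range
      induction z using Finsupp.induction_linear with
      | zero => simp
      | add a b ha hb =>
        rw [map_add]
        exact add_mem ha hb
      | single z n =>
        obtain ⟨w, hw⟩ := exists_mk_eq_mk_pushforward_sectionMap πX πY hdeg hy hyE hs z
        have h1 : CH0.mk (Finsupp.single z 1) = S (CH0.mk w) := by
          rw [← sub_eq_zero]
          exact (QuotientAddGroup.eq_zero_iff _).mpr hw
        have h2 : (Finsupp.single z n : ZeroCycle _ (prodDivisor πX πY D E)) =
            n • Finsupp.single z 1 := by simp
        rw [h2, map_zsmul, h1]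
        exact zsmul_mem (AddMonoidHom.mem_range.mpr ⟨_, rfl⟩) n
  refine ⟨AddEquiv.ofBijective P ⟨fun a b hab => ?_, fun a => ⟨S a, hPS a⟩⟩, fun z => rfl⟩
  obtain ⟨a, rfl⟩ := hS a
  obtain ⟨b, rfl⟩ := hS b
  rw [hPS, hPS] at hab
  rw [hab]

end Projection

/-! ### Lengths and norms -/

section Length

open TensorProduct

variable {S : Type*} [CommRing S]

/-- Length after a flat base change is additive in short exact sequences. -/
theorem length_tensorProduct_of_exact {A B N₁ N₂ N₃ : Type*} [CommRing A] [CommRing B]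
    [Algebra A B] [Algebra S B] [Module.Flat S B] [AddCommGroup N₁] [AddCommGroup N₂]
    [AddCommGroup N₃] [Module S N₁] [Module S N₂] [Module S N₃] {f : N₁ →ₗ[S] N₂}
    {g : N₂ →ₗ[S] N₃} (hf : Function.Injective f) (hg : Function.Surjective g)
    (h : Function.Exact f g) :
    Module.length A (B ⊗[S] N₂) = Module.length A (B ⊗[S] N₁) + Module.length A (B ⊗[S] N₃) :=
  Module.length_eq_add_of_exact ((f.baseChange B).restrictScalars A)
    ((g.baseChange B).restrictScalars A)
    (Module.Flat.lTensor_preserves_injective_linearMap f hf) (LinearMap.lTensor_surjective B hg)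
    (lTensor_exact B h hg)

/-- A module killed by an element that becomes a unit disappears after base change. -/
theorem length_tensorProduct_eq_zero {A B N : Type*} [CommRing A] [CommRing B] [Algebra A B]
    [Algebra S B] [AddCommGroup N] [Module S N] {s : S} (hs : IsUnit (algebraMap S B s))
    (hN : ∀ n : N, s • n = 0) : Module.length A (B ⊗[S] N) = 0 := by
  rw [Module.length_eq_zero_iff]
  obtain ⟨u, hu⟩ := hs
  refine subsingleton_of_forall_eq 0 fun x => ?_
  induction x using TensorProduct.induction_on with
  | zero => rfl
  | add a b ha hb => rw [ha, hb, add_zero]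
  | tmul b n =>
    have : b = s • ((u⁻¹ : Bˣ) * b) := by
      rw [Algebra.smul_def, ← hu, Units.mul_inv_cancel_left]
    rw [this, smul_tmul, hN, tmul_zero]

/-- If `κ` is a `B`-module, `B` is a localisation of `S`, and `κ ≃ N` as `S`-modules, then
localising `N` to `B` does nothing. -/
theorem length_tensorProduct_of_linearEquiv {A B N κ : Type*} [CommRing A] [CommRing B]
    [Algebra A B] [Algebra S B] (W : Submonoid S) [IsLocalization W B] [AddCommGroup N]
    [Module S N] [AddCommGroup κ] [Module S κ] [Module B κ] [IsScalarTower S B κ] [Module A κ]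
    [IsScalarTower A B κ] (e : N ≃ₗ[S] κ) :
    Module.length A (B ⊗[S] N) = Module.length A κ := by
  have h1 : IsLocalizedModule W (LinearMap.id : κ →ₗ[S] κ) := isLocalizedModule_id W κ B
  have h2 : IsLocalizedModule W ((LinearMap.id : κ →ₗ[S] κ) ∘ₗ e.toLinearMap) :=
    IsLocalizedModule.of_linearEquiv_right W LinearMap.id e
  exact ((IsLocalizedModule.isBaseChange W B
    ((LinearMap.id : κ →ₗ[S] κ) ∘ₗ e.toLinearMap)).equiv.restrictScalars A).length_eq

/-- The residue field of the localisation at a maximal ideal `P` is `S ⧸ P`. -/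
def quotientEquivResidueField (P : Ideal S) [P.IsMaximal] (B : Type*) [CommRing B] [Algebra S B]
    [IsLocalization.AtPrime B P] [IsLocalRing B] : (S ⧸ P) ≃ₗ[S] IsLocalRing.ResidueField B :=
  { IsLocalization.AtPrime.equivQuotMaximalIdeal P B with
    map_smul' := fun s x => by
      obtain ⟨x, rfl⟩ := Ideal.Quotient.mk_surjective x
      change IsLocalRing.residue B (algebraMap S B (s * x)) =
        s • IsLocalRing.residue B (algebraMap S B x)
      rw [map_mul, map_mul, Algebra.smul_def]
      rfl }

/-- Dévissage: let `T` be the semi-localisation of `S` at finitely many maximal ideals `P i`, with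
local rings `B i`. Then the length of `T ⊗ M` over a ring `A` with `A → T` is the sum of the local
lengths of `M`, weighted by the lengths of the residue fields. Both sides are additive in `M`,
which reduces the claim to `M = S ⧸ Q`. -/
theorem length_semilocalization {A T : Type*} [CommRing A] [CommRing T] [Algebra S T] [Algebra A T]
    [IsNoetherianRing S]
    (W : Submonoid S) [IsLocalization W T] {ι : Type*} [Fintype ι] (P : ι → Ideal S)
    [∀ i, (P i).IsMaximal] (hP : Function.Injective P)
    (hPW : ∀ Q : Ideal S, Q.IsMaximal → (∃ i, P i = Q) ∨ ∃ w ∈ W, w ∈ Q)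
    (B : ι → Type*) [∀ i, CommRing (B i)] [∀ i, Algebra S (B i)]
    [∀ i, IsLocalization.AtPrime (B i) (P i)] [∀ i, IsLocalRing (B i)]
    [∀ i, Algebra T (B i)] [∀ i, IsScalarTower S T (B i)]
    [∀ i, Algebra A (B i)] [∀ i, IsScalarTower A T (B i)]
    (g : S) (hg : ∀ Q : Ideal S, Q.IsPrime → g ∈ Q → Q.IsMaximal)
    (M : Type*) [AddCommGroup M] [Module S M] [Module.Finite S M] (hM : ∀ m : M, g • m = 0) :
    Module.length A (T ⊗[S] M) =
      ∑ i, Module.length (B i) (B i ⊗[S] M) *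
        Module.length A (IsLocalRing.ResidueField (B i)) := by
  have : Module.Flat S T := IsLocalization.flat T W
  have hflat (i : ι) : Module.Flat S (B i) := IsLocalization.flat (B i) (P i).primeCompl
  revert hM
  induction ‹Module.Finite S M› using
    IsNoetherianRing.induction_on_isQuotientEquivQuotientPrime S with
  | subsingleton N => intro _; simp [Module.length_eq_zero]
  | exact N₁ N₂ N₃ f g' hf hg' hfg h1 h3 =>
    intro hM
    have h1' := h1 fun m => hf (by rw [map_smul, hM, map_zero])
    have h3' := h3 fun m => by
      obtain ⟨m, rfl⟩ := hg' m
      rw [← map_smul, hM, map_zero]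
    rw [length_tensorProduct_of_exact hf hg' hfg, h1', h3', ← Finset.sum_add_distrib]
    refine Finset.sum_congr rfl fun i _ => ?_
    rw [length_tensorProduct_of_exact (A := B i) hf hg' hfg, add_mul]
  | quotient N Q e =>
    intro hM
    have hgQ : g ∈ Q.asIdeal := by
      have h1 := hM (e.symm 1)
      rw [← map_smul, LinearEquiv.map_eq_zero_iff] at h1
      rwa [← Ideal.Quotient.eq_zero_iff_mem, ← mul_one (Ideal.Quotient.mk Q.asIdeal g)]
    have hQ := hg Q.asIdeal Q.isPrime hgQ
    have hQN (s : S) (hs : s ∈ Q.asIdeal) (n : N) : s • n = 0 := by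
      apply e.injective
      obtain ⟨x, hx⟩ := Ideal.Quotient.mk_surjective (e n)
      rw [map_smul, map_zero, ← hx, Algebra.smul_def, Ideal.Quotient.algebraMap_eq,
        Ideal.Quotient.eq_zero_iff_mem.mpr hs, zero_mul]
    rcases hPW Q.asIdeal hQ with ⟨i, hi⟩ | ⟨w, hw, hwQ⟩
    -- `Q` is one of the `P i`: only the `i`-th summand survives, with local length one
    · have e' : N ≃ₗ[S] IsLocalRing.ResidueField (B i) :=
        (e.trans (Submodule.quotEquivOfEq _ _ hi.symm)).trans
          (quotientEquivResidueField (P i) (B i))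
      have h0 : Module.length A (T ⊗[S] N) = Module.length A (IsLocalRing.ResidueField (B i)) :=
        length_tensorProduct_of_linearEquiv W e'
      have h1 : Module.length (B i) (B i ⊗[S] N) = 1 := by
        rw [length_tensorProduct_of_linearEquiv (P i).primeCompl e', Module.length_eq_one_iff]
        exact isSimpleModule_iff_quot_maximal.mpr
          ⟨_, IsLocalRing.maximalIdeal.isMaximal (B i), ⟨LinearEquiv.refl _ _⟩⟩
      rw [h0, Finset.sum_eq_single i]
      · rw [h1, one_mul]
      · intro j _ hj
        obtain ⟨s, hsQ, hsP⟩ : ∃ s ∈ Q.asIdeal, s ∉ P j := by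
          by_contra! hle
          have : (P j) = Q.asIdeal := (hQ.eq_of_le (Ideal.IsPrime.ne_top inferInstance) hle).symm
          exact hj (hP (this.trans hi.symm))
        rw [length_tensorProduct_eq_zero (A := B j)
          (IsLocalization.map_units (B j) (⟨s, hsP⟩ : (P j).primeCompl)) (hQN s hsQ), zero_mul]
      · simp
    -- `Q` is none of the `P i`: everything vanishes
    · rw [length_tensorProduct_eq_zero (A := A)
        (IsLocalization.map_units T (⟨w, hw⟩ : W)) (hQN w hwQ)]
      refine (Finset.sum_eq_zero fun i _ => ?_).symm
      have hwB : IsUnit (algebraMap S (B i) w) := by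
        rw [IsScalarTower.algebraMap_apply S T (B i)]
        exact (IsLocalization.map_units T (⟨w, hw⟩ : W)).map _
      rw [length_tensorProduct_eq_zero (A := B i) hwB (hQN w hwQ), zero_mul]

theorem length_tensorProduct_quotient_span {A B : Type*} [CommRing A] [CommRing B] [Algebra A B]
    [Algebra S B] (f : S) :
    Module.length A (B ⊗[S] (S ⧸ Ideal.span {f})) =
      Module.length A (B ⧸ Ideal.span {algebraMap S B f}) := by
  have h := ((Algebra.TensorProduct.quotIdealMapEquivTensorQuot B
    (Ideal.span {f})).toLinearEquiv.restrictScalars A).length_eq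
  rw [← h, Ideal.map_span, Set.image_singleton]

/-- The length of `T ⧸ t` over a principal ideal domain is the order of the norm of `t`. -/
theorem length_quotient_span_eq_ord_norm {A T : Type*} [CommRing A] [IsDomain A]
    [IsPrincipalIdealRing A] [CommRing T] [IsDomain T] [Algebra A T] [Module.Free A T]
    [Module.Finite A T] {t : T} (ht : t ≠ 0) :
    Module.length A (T ⧸ Ideal.span {t}) = Ring.ord A (Algebra.norm A t) := by
  classical
  -- Smith normal form: `T ⧸ t` is a product of the `A ⧸ cᵢ`, and the norm of `t` is associated to
  -- the product of the `cᵢ`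
  let b := Module.Free.chooseBasis A T
  have hI := Ideal.span_singleton_eq_bot.not.2 ht
  rw [(Ideal.quotientEquivPiSpan (Ideal.span {t}) b hI).length_eq, Module.length_pi_of_fintype,
    Ring.ord_eq_of_associated (associated_norm_prod_smith b ht)]
  have hne (i) : Ideal.smithCoeffs b _ hI i ∈ nonZeroDivisors A :=
    mem_nonZeroDivisors_of_ne_zero (Ideal.smithCoeffs_ne_zero b _ hI i)
  generalize hc : Ideal.smithCoeffs b _ hI = c at *
  change ∑ i, Ring.ord A (c i) = Ring.ord A (∏ i, c i)
  induction (Finset.univ : Finset (Module.Free.ChooseBasisIndex A T)) using Finset.induction_on with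
  | empty => simp
  | insert i s hi ih =>
    rw [Finset.sum_insert hi, Finset.prod_insert hi, Ring.ord_mul' A (hne i), ih]

/-- The order of vanishing of a norm: if `S` is finite over a principal ideal domain `R`, then at a
prime `p` of `R` with local ring `A`, the order of the norm of `f` is the sum of the
orders of `f` at the primes `P i` over `p`, weighted by the residue degrees. -/
theorem ord_norm_eq_sum {R : Type*} [CommRing R] [IsDomain R] [IsPrincipalIdealRing R]
    [IsDomain S] [Algebra R S] [Module.Finite R S] [Module.IsTorsionFree R S]
    (p : Ideal R) [p.IsMaximal] (A : Type*) [CommRing A] [Algebra R A] [IsLocalRing A]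
    [IsLocalization.AtPrime A p] {ι : Type*} [Fintype ι]
    (P : ι → Ideal S) [∀ i, (P i).IsMaximal] (hP : Function.Injective P)
    (hPp : ∀ Q : Ideal S, Q.IsMaximal → ((∃ i, P i = Q) ↔ Q.comap (algebraMap R S) = p))
    (B : ι → Type*) [∀ i, CommRing (B i)] [∀ i, Algebra S (B i)]
    [∀ i, IsLocalization.AtPrime (B i) (P i)] [∀ i, IsLocalRing (B i)]
    [∀ i, Algebra A (B i)] [∀ i, Algebra R (B i)] [∀ i, IsScalarTower R S (B i)]
    [∀ i, IsScalarTower R A (B i)] [∀ i, IsLocalHom (algebraMap A (B i))]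
    {f : S} (hf : f ≠ 0) :
    Ring.ord A (algebraMap R A (Algebra.norm R f)) =
      ∑ i, Ring.ord (B i) (algebraMap S (B i) f) *
        Module.finrank (IsLocalRing.ResidueField A) (IsLocalRing.ResidueField (B i)) := by
  -- Both sides are the length over `A` of `T ⧸ f`, where `T = S ⊗ A` is the semi-localisation of `S`
  -- at the primes over `p`, which is free over `A`.
  let W := Algebra.algebraMapSubmonoid S p.primeCompl
  let T := Localization W
  have : IsNoetherianRing S := IsNoetherianRing.of_finite R S
  have hW0 : W ≤ nonZeroDivisors S := by
    rintro _ ⟨r, hr, rfl⟩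
    refine mem_nonZeroDivisors_of_ne_zero ?_
    rw [Ne, map_eq_zero_iff _ (FaithfulSMul.algebraMap_injective R S)]
    rintro rfl
    exact hr p.zero_mem
  have : IsDomain T := IsLocalization.isDomain_localization hW0
  let : Algebra A T := localizationAlgebra p.primeCompl S
  have : IsScalarTower R A T := isScalarTower_localizationAlgebra p.primeCompl S
  have : Module.Finite A T := Module.Finite.of_isLocalization R S p.primeCompl
  have : Module.Free R S := Module.free_of_finite_type_torsion_free'
  have : IsLocalizedModule p.primeCompl (IsScalarTower.toAlgHom R S T).toLinearMap :=
    inferInstance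
  have : Module.Free A T := Module.free_of_isLocalizedModule p.primeCompl
    (IsScalarTower.toAlgHom R S T).toLinearMap
  have hA0 : p.primeCompl ≤ nonZeroDivisors R := p.primeCompl_le_nonZeroDivisors
  have : IsDomain A := IsLocalization.isDomain_of_le_nonZeroDivisors A hA0
  have : IsDedekindDomain A := IsLocalization.isDedekindDomain R hA0 A
  have : IsPrincipalIdealRing A := inferInstance
  have hPi (i) : (P i).comap (algebraMap R S) = p := (hPp (P i) inferInstance).mp ⟨i, rfl⟩
  have hunit (i) (w : W) : IsUnit (algebraMap S (B i) w) := by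
    obtain ⟨_, r, hr, rfl⟩ := w
    refine IsLocalization.map_units (B i) (⟨algebraMap R S r, fun h => hr ?_⟩ : (P i).primeCompl)
    rw [← hPi i]
    exact h
  let algTB : ∀ i, Algebra T (B i) := fun i => (IsLocalization.lift (hunit i)).toAlgebra
  have hST : ∀ i, IsScalarTower S T (B i) := fun i =>
    IsScalarTower.of_algebraMap_eq fun x => (IsLocalization.lift_eq (hunit i) x).symm
  have hAT : ∀ i, IsScalarTower A T (B i) := fun i => by
    refine IsScalarTower.of_algebraMap_eq' (IsLocalization.ringHom_ext p.primeCompl ?_)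
    ext r
    simp only [RingHom.comp_apply]
    rw [← IsScalarTower.algebraMap_apply R A T, ← IsScalarTower.algebraMap_apply R A (B i),
      IsScalarTower.algebraMap_apply R S T, ← IsScalarTower.algebraMap_apply S T (B i),
      ← IsScalarTower.algebraMap_apply R S (B i)]
  have hT : algebraMap S T f ≠ 0 := by
    rw [Ne, map_eq_zero_iff _ (IsLocalization.injective T hW0)]
    exact hf
  have hmax (Q : Ideal S) (hQ : Q.IsPrime) (hfQ : f ∈ Q) : Q.IsMaximal := by
    have h1 : Q.comap (algebraMap R S) ≠ ⊥ :=
      Ideal.comap_ne_bot_of_integral_mem hf hfQ (Algebra.IsIntegral.isIntegral f)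
    have h2 : (Q.comap (algebraMap R S)).IsMaximal :=
      IsPrime.to_maximal_ideal h1
    exact Ideal.isMaximal_of_isIntegral_of_isMaximal_comap Q h2
  have key := length_semilocalization (A := A) (T := T) W P hP
    (fun Q hQ => by
      by_cases h : Q.comap (algebraMap R S) = p
      · exact Or.inl ((hPp Q hQ).mpr h)
      · have h1 : (Q.comap (algebraMap R S)).IsMaximal :=
          Ideal.isMaximal_comap_of_isIntegral_of_isMaximal Q
        obtain ⟨r, hrQ, hrp⟩ : ∃ r ∈ Q.comap (algebraMap R S), r ∉ p := by
          by_contra! hle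
          exact h (h1.eq_of_le (Ideal.IsPrime.ne_top inferInstance) hle)
        exact Or.inr ⟨algebraMap R S r, ⟨r, hrp, rfl⟩, hrQ⟩) B f hmax (S ⧸ Ideal.span {f})
    (fun m => by
      obtain ⟨m, rfl⟩ := Ideal.Quotient.mk_surjective m
      rw [Algebra.smul_def, Ideal.Quotient.algebraMap_eq,
        Ideal.Quotient.eq_zero_iff_mem.mpr (Ideal.mem_span_singleton_self f), zero_mul])
  rw [length_tensorProduct_quotient_span, length_quotient_span_eq_ord_norm hT,
    Algebra.norm_localization R p.primeCompl] at key
  rw [key]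
  refine Finset.sum_congr rfl fun i _ => ?_
  have : Module.Finite R (IsLocalRing.ResidueField (B i)) :=
    Module.Finite.of_surjective
      ((quotientEquivResidueField (P i) (B i)).restrictScalars R).toLinearMap
      (quotientEquivResidueField (P i) (B i)).surjective
  have : Module.Finite (IsLocalRing.ResidueField A) (IsLocalRing.ResidueField (B i)) :=
    Module.Finite.of_restrictScalars_finite R _ _
  rw [length_tensorProduct_quotient_span, Ring.ord,
    Module.length_eq_of_surjective (IsLocalRing.residue_surjective (R := A)),
    Module.length_eq_finrank]

end Length

/-! ### Push-forward of principal divisors -/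

section Norm

/-- On regular elements the order at a point of codimension one is the length of a quotient of the
local ring. -/
theorem exists_ord_algebraMap_eq {C : Scheme.{u}} [IsIntegral C] [IsLocallyNoetherian C] {x : C}
    (hx : Order.coheight x = 1) {a : C.presheaf.stalk x} (ha : a ≠ 0) :
    ∃ n : ℕ, Ring.ord (C.presheaf.stalk x) a = n ∧
      Scheme.ord (algebraMap _ C.functionField a) x = n := by
  have : Ring.KrullDimLE 1 (C.presheaf.stalk x) := krullDimLE_of_coheight_le hx.le
  have ha' := mem_nonZeroDivisors_of_ne_zero ha
  obtain ⟨n, hn⟩ := ENat.ne_top_iff_exists.mp (Ring.ord_ne_top ha')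
  refine ⟨n, hn.symm, ?_⟩
  have h0 : algebraMap _ C.functionField a ≠ 0 := by
    rwa [Ne, map_eq_zero_iff _ (IsFractionRing.injective (C.presheaf.stalk x) C.functionField)]
  rw [Scheme.ord_eq_iff hx h0]
  exact (Ring.ordFrac_eq_ord _ ha).trans (Ring.ordMonoidWithZeroHom_eq_coe _ ha' hn.symm)

/-- The order at `x` of a regular function near `x`, as the length of a quotient of the local
ring. -/
theorem exists_ord_germ_eq {C : Scheme.{u}} [IsIntegral C] [IsLocallyNoetherian C] {x : C}
    (hx : Order.coheight x = 1) {U : C.Opens} [Nonempty U] (hxU : x ∈ U) {a : Γ(C, U)}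
    (ha : a ≠ 0) :
    ∃ n : ℕ, Ring.ord (C.presheaf.stalk x) (C.presheaf.germ U x hxU a) = n ∧
      Scheme.ord (C.germToFunctionField U a) x = n := by
  rw [← Scheme.algebraMap_germ_eq_germToFunctionField C hxU]
  refine exists_ord_algebraMap_eq hx ?_
  rwa [Ne, map_eq_zero_iff _ (germ_injective_of_isIntegral C x hxU)]

variable {C P : Scheme.{u}}

theorem cycleMap_apply (φ : C ⟶ P) (z : C →₀ ℤ) (p : P) [Fintype {x : C // φ x = p}] :
    cycleMap φ z p = ∑ i : {x : C // φ x = p}, z i.1 * φ.residueDegree i.1 := by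
  classical
  induction z using Finsupp.induction_linear with
  | zero => simp
  | add a b ha hb => simp [ha, hb, add_mul, Finset.sum_add_distrib]
  | single x n =>
    rw [cycleMap_single, Finsupp.single_apply]
    split_ifs with h
    · rw [Finset.sum_eq_single ⟨x, h⟩, Finsupp.single_eq_same, mul_comm]
      · rintro ⟨y, hy⟩ _ hne
        rw [Finsupp.single_eq_of_ne (fun h' => hne (Subtype.ext h')), zero_mul]
      · simp
    · refine (Finset.sum_eq_zero fun i _ => ?_).symm
      rw [Finsupp.single_eq_of_ne (fun h' => h (by rw [← h']; exact i.2)), zero_mul]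

/-- The homomorphism of local rings at a point `x` over `p`. The equality `φ x = p` is kept as a
hypothesis, so that the local rings at all points of a fibre receive a map from one and the same
ring. -/
def stalkMapOver (φ : C ⟶ P) {x : C} {p : P} (h : φ x = p) :
    P.presheaf.stalk p ⟶ C.presheaf.stalk x :=
  P.presheaf.stalkSpecializes (specializes_of_eq h) ≫ φ.stalkMap x

theorem stalkMapOver_rfl (φ : C ⟶ P) (x : C) :
    stalkMapOver φ (rfl : φ x = φ x) = φ.stalkMap x := by
  simp [stalkMapOver]

theorem germ_stalkMapOver (φ : C ⟶ P) {x : C} {p : P} (h : φ x = p) (U : P.Opens) (hp : p ∈ U)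
    (hx : x ∈ φ ⁻¹ᵁ U) (r : Γ(P, U)) :
    (stalkMapOver φ h).hom (P.presheaf.germ U p hp r) =
      C.presheaf.germ (φ ⁻¹ᵁ U) x hx (φ.app U r) := by
  subst h
  rw [stalkMapOver_rfl]
  exact Scheme.Hom.germ_stalkMap_apply φ U x hp r

instance isLocalHom_stalkMapOver (φ : C ⟶ P) {x : C} {p : P} (h : φ x = p) :
    IsLocalHom (stalkMapOver φ h).hom := by
  subst h
  rw [stalkMapOver_rfl]
  infer_instance

theorem finrank_stalkMapOver (φ : C ⟶ P) {x : C} {p : P} (h : φ x = p) :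
    letI := (stalkMapOver φ h).hom.toAlgebra
    haveI : IsLocalHom (algebraMap (P.presheaf.stalk p) (C.presheaf.stalk x)) :=
      isLocalHom_stalkMapOver φ h
    Module.finrank (IsLocalRing.ResidueField (P.presheaf.stalk p))
      (IsLocalRing.ResidueField (C.presheaf.stalk x)) = φ.residueDegree x := by
  subst h
  -- `stalkMapOver` equals the stalk map only propositionally, so it is replaced by a variable
  have key : ∀ (g : P.presheaf.stalk (φ x) ⟶ C.presheaf.stalk x), g = φ.stalkMap x →
      letI := g.hom.toAlgebra
      ∀ [IsLocalHom (algebraMap (P.presheaf.stalk (φ x)) (C.presheaf.stalk x))],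
        Module.finrank (IsLocalRing.ResidueField (P.presheaf.stalk (φ x)))
          (IsLocalRing.ResidueField (C.presheaf.stalk x)) = φ.residueDegree x := by
    rintro _ rfl hl
    let := (φ.stalkMap x).hom.toAlgebra
    let := (φ.residueFieldMap x).hom.toAlgebra
    refine Algebra.finrank_eq_of_equiv_equiv (RingEquiv.refl (P.residueField (φ x)))
      (RingEquiv.refl (C.residueField x)) ?_
    ext r
    obtain ⟨r, rfl⟩ := IsLocalRing.residue_surjective r
    rfl
  exact @key _ (stalkMapOver_rfl φ x) (isLocalHom_stalkMapOver φ rfl)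

variable [IsIntegral C] [IsIntegral P]

/-- A finite morphism of integral curves is dominant: otherwise the source would be a finite
discrete space. -/
theorem map_genericPoint_of_isFinite (φ : C ⟶ P) [IsFinite φ] (hC : topologicalKrullDim C = 1)
    (hP : topologicalKrullDim P = 1) : φ (genericPoint C) = genericPoint P := by
  by_contra h
  have hcl := isClosed_singleton_of_ne_genericPoint hP h
  have hall (x : C) : φ x = φ (genericPoint C) := by
    have := ((genericPoint_specializes x).map φ.continuous).mem_closed hcl rfl
    simpa using this
  have h1 : _root_.IsDiscrete (φ ⁻¹' {φ (genericPoint C)}) := φ.isDiscrete_preimage_singleton _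
  have h2 : φ ⁻¹' {φ (genericPoint C)} = Set.univ := Set.eq_univ_of_forall hall
  rw [h2] at h1
  have : DiscreteTopology C := isDiscrete_univ_iff.mp h1
  have h3 := topologicalKrullDim_zero_of_discreteTopology C
  rw [hC] at h3
  exact absurd h3 (by decide)

/-- Over an affine open whose ring of functions is a principal ideal domain, the push-forward of
the divisor of a regular function is the divisor of its norm. -/
theorem ord_norm_eq_cycleMap [IsNoetherian C] [IsNoetherian P] (φ : C ⟶ P) [IsFinite φ]
    (hC : topologicalKrullDim C = 1) (hP : topologicalKrullDim P = 1)
    (U : P.Opens) (hU : IsAffineOpen U) [IsPrincipalIdealRing Γ(P, U)] [Nonempty U]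
    [Nonempty (φ ⁻¹ᵁ U)] (p : P) (hpU : p ∈ U) (hp : IsClosed ({p} : Set P))
    (f : Γ(C, φ ⁻¹ᵁ U)) (hf : f ≠ 0) :
    letI := (φ.app U).hom.toAlgebra
    cycleMap φ (principalCycle C (C.germToFunctionField (φ ⁻¹ᵁ U) f)) p =
      Scheme.ord (P.germToFunctionField U (Algebra.norm Γ(P, U) f)) p := by
  let : Algebra Γ(P, U) Γ(C, φ ⁻¹ᵁ U) := (φ.app U).hom.toAlgebra
  have : Module.Finite Γ(P, U) Γ(C, φ ⁻¹ᵁ U) := φ.finite_app U hU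
  have hgen := map_genericPoint_of_isFinite φ hC hP
  have hinj : Function.Injective (algebraMap Γ(P, U) Γ(C, φ ⁻¹ᵁ U)) := by
    rw [injective_iff_map_eq_zero]
    intro r hr
    have h1 : φ ⁻¹ᵁ P.basicOpen r = C.basicOpen (φ.app U r) := Scheme.preimage_basicOpen φ r
    have h2 : φ.app U r = 0 := hr
    rw [h2, Scheme.basicOpen_zero] at h1
    rw [← basicOpen_eq_bot_iff]
    by_contra h3
    have h4 : genericPoint P ∈ P.basicOpen r :=
      ((genericPoint_spec P).mem_open_set_iff (P.basicOpen r).isOpen).mpr (by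
        rw [Set.univ_inter, Set.nonempty_iff_ne_empty]
        exact fun h => h3 (TopologicalSpace.Opens.ext h))
    have h5 : genericPoint C ∈ φ ⁻¹ᵁ P.basicOpen r := by
      change φ (genericPoint C) ∈ P.basicOpen r
      rwa [hgen]
    rw [h1] at h5
    exact h5
  have : FaithfulSMul Γ(P, U) Γ(C, φ ⁻¹ᵁ U) := (faithfulSMul_iff_algebraMap_injective _ _).mpr hinj
  have : Module.IsTorsionFree Γ(P, U) Γ(C, φ ⁻¹ᵁ U) := inferInstance
  have hV : IsAffineOpen (φ ⁻¹ᵁ U) := hU.preimage φ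
  have : Finite {x : C // φ x = p} := φ.finite_preimage_singleton p
  let : Fintype {x : C // φ x = p} := Fintype.ofFinite _
  have hmem (i : {x : C // φ x = p}) : i.1 ∈ φ ⁻¹ᵁ U := by
    change φ i.1 ∈ U
    rwa [i.2]
  have hcl (i : {x : C // φ x = p}) : IsClosed ({i.1} : Set C) := by
    refine isClosed_singleton_of_ne_genericPoint hC fun h => ?_
    refine ne_genericPoint_of_isClosed hP hp ?_
    rw [← i.2, h, hgen]
  let A : Type u := P.presheaf.stalk p
  let algA : Algebra Γ(P, U) A := P.presheaf.algebra_section_stalk ⟨p, hpU⟩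
  have locA : IsLocalization.AtPrime A (hU.primeIdealOf ⟨p, hpU⟩).asIdeal :=
    hU.isLocalization_stalk ⟨p, hpU⟩
  have maxA := hU.primeIdealOf_isMaximal_of_isClosed ⟨p, hpU⟩ hp
  let B (i : {x : C // φ x = p}) : Type u := C.presheaf.stalk i.1
  let algB (i : {x : C // φ x = p}) : Algebra Γ(C, φ ⁻¹ᵁ U) (B i) :=
    C.presheaf.algebra_section_stalk ⟨i.1, hmem i⟩
  let Q (i : {x : C // φ x = p}) := (hV.primeIdealOf ⟨i.1, hmem i⟩).asIdeal
  have locB (i : {x : C // φ x = p}) : IsLocalization.AtPrime (B i) (Q i) :=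
    hV.isLocalization_stalk ⟨i.1, hmem i⟩
  have maxB (i : {x : C // φ x = p}) : (Q i).IsMaximal :=
    hV.primeIdealOf_isMaximal_of_isClosed ⟨i.1, hmem i⟩ (hcl i)
  let algAB (i : {x : C // φ x = p}) : Algebra A (B i) := (stalkMapOver φ i.2).hom.toAlgebra
  let algRB (i : {x : C // φ x = p}) : Algebra Γ(P, U) (B i) :=
    ((algebraMap Γ(C, φ ⁻¹ᵁ U) (B i)).comp (algebraMap Γ(P, U) Γ(C, φ ⁻¹ᵁ U))).toAlgebra
  have t1 (i : {x : C // φ x = p}) : IsScalarTower Γ(P, U) Γ(C, φ ⁻¹ᵁ U) (B i) :=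
    IsScalarTower.of_algebraMap_eq fun _ => rfl
  have t2 (i : {x : C // φ x = p}) : IsScalarTower Γ(P, U) A (B i) :=
    IsScalarTower.of_algebraMap_eq fun r =>
      (germ_stalkMapOver φ i.2 U hpU (hmem i) r).symm
  have loc (i : {x : C // φ x = p}) : IsLocalHom (algebraMap A (B i)) :=
    isLocalHom_stalkMapOver φ i.2
  -- the prime of a point of the curve contracts to the prime of its image
  have hover (x : C) (hx : x ∈ φ ⁻¹ᵁ U) :
      (hV.primeIdealOf ⟨x, hx⟩).asIdeal.comap (algebraMap Γ(P, U) Γ(C, φ ⁻¹ᵁ U)) =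
        (hU.primeIdealOf ⟨φ x, hx⟩).asIdeal := by
    have := congrArg PrimeSpectrum.asIdeal
      (IsAffineOpen.comap_primeIdealOf_appLE (f := φ) U hU (φ ⁻¹ᵁ U) hV le_rfl hx)
    rw [Scheme.Hom.appLE_eq_app] at this
    exact this
  have hQinj : Function.Injective Q := by
    intro i j hij
    have h1 : hV.primeIdealOf ⟨i.1, hmem i⟩ = hV.primeIdealOf ⟨j.1, hmem j⟩ :=
      PrimeSpectrum.ext hij
    have h2 := hV.fromSpec_primeIdealOf ⟨i.1, hmem i⟩
    rw [h1, hV.fromSpec_primeIdealOf] at h2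
    exact Subtype.ext h2.symm
  have key := ord_norm_eq_sum (R := Γ(P, U)) (S := Γ(C, φ ⁻¹ᵁ U))
    (hU.primeIdealOf ⟨p, hpU⟩).asIdeal A Q hQinj (fun M hM => by
      constructor
      · rintro ⟨i, rfl⟩
        refine (hover i.1 (hmem i)).trans ?_
        congr 3
        exact i.2
      · intro hMp
        have hxV : hV.fromSpec ⟨M, hM.isPrime⟩ ∈ φ ⁻¹ᵁ U := by
          have : hV.fromSpec ⟨M, hM.isPrime⟩ ∈ Set.range hV.fromSpec := ⟨_, rfl⟩
          rwa [hV.range_fromSpec] at this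
        have h1 : hV.primeIdealOf ⟨hV.fromSpec ⟨M, hM.isPrime⟩, hxV⟩ = ⟨M, hM.isPrime⟩ :=
          hV.fromSpec.isOpenEmbedding.injective (hV.fromSpec_primeIdealOf _)
        have h2 := hover _ hxV
        rw [h1] at h2
        have h3 : hU.primeIdealOf ⟨φ (hV.fromSpec ⟨M, hM.isPrime⟩), hxV⟩ =
            hU.primeIdealOf ⟨p, hpU⟩ := PrimeSpectrum.ext (h2.symm.trans hMp)
        have h4 := hU.fromSpec_primeIdealOf ⟨φ (hV.fromSpec ⟨M, hM.isPrime⟩), hxV⟩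
        rw [h3, hU.fromSpec_primeIdealOf] at h4
        exact ⟨⟨_, h4.symm⟩, congrArg PrimeSpectrum.asIdeal h1⟩) B hf
  have hN : Algebra.norm Γ(P, U) f ≠ 0 := by
    have : Module.Free Γ(P, U) Γ(C, φ ⁻¹ᵁ U) := Module.free_of_finite_type_torsion_free'
    exact Algebra.norm_ne_zero_iff.mpr hf
  obtain ⟨n, hn, hn'⟩ := exists_ord_germ_eq (coheight_eq_one_of_isClosed hP hp) hpU hN
  choose m hm hm' using fun i : {x : C // φ x = p} =>
    exists_ord_germ_eq (coheight_eq_one_of_isClosed hC (hcl i)) (hmem i) hf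
  rw [cycleMap_apply, hn']
  have h1 (i : {x : C // φ x = p}) : Ring.ord (B i) (algebraMap Γ(C, φ ⁻¹ᵁ U) (B i) f) = m i :=
    hm i
  have h2 : Ring.ord A (algebraMap Γ(P, U) A (Algebra.norm Γ(P, U) f)) = n := hn
  have h3 (i : {x : C // φ x = p}) : Module.finrank (IsLocalRing.ResidueField A)
      (IsLocalRing.ResidueField (B i)) = φ.residueDegree i.1 := finrank_stalkMapOver φ i.2
  simp only [h1, h2, h3] at key
  simp only [principalCycle_apply, hm']
  exact_mod_cast key.symm

/-- The push-forward of a principal divisor along a finite morphism onto a curve that is locally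
the spectrum of a principal ideal domain is again principal: it is the divisor of the norm. -/
theorem exists_cycleMap_principalCycle_eq [IsNoetherian C] [IsNoetherian P] (φ : C ⟶ P)
    [IsFinite φ] (hC : topologicalKrullDim C = 1) (hP : topologicalKrullDim P = 1)
    (hU : ∀ p : P, ∃ U : P.Opens, p ∈ U ∧ IsAffineOpen U ∧ IsPrincipalIdealRing Γ(P, U))
    {f : C.functionField} (hf : f ≠ 0) :
    ∃ g : P.functionField, g ≠ 0 ∧
      cycleMap φ (principalCycle C f) = principalCycle P g := by
  have hgen := map_genericPoint_of_isFinite φ hC hP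
  let algK : Algebra P.functionField C.functionField := (stalkMapOver φ hgen).hom.toAlgebra
  -- The compatibility of the global norm with the norms over the members of the cover.
  have loc (U : P.Opens) (hUa : IsAffineOpen U) (hUp : IsPrincipalIdealRing Γ(P, U))
      [Nonempty U] [Nonempty (φ ⁻¹ᵁ U)] :
      letI := (φ.app U).hom.toAlgebra
      Module.Finite P.functionField C.functionField ∧ ∀ a : Γ(C, φ ⁻¹ᵁ U),
        Algebra.norm P.functionField (C.germToFunctionField (φ ⁻¹ᵁ U) a) =
          P.germToFunctionField U (Algebra.norm Γ(P, U) a) := by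
    let : Algebra Γ(P, U) Γ(C, φ ⁻¹ᵁ U) := (φ.app U).hom.toAlgebra
    have : Module.Finite Γ(P, U) Γ(C, φ ⁻¹ᵁ U) := φ.finite_app U hUa
    have := functionField_isFractionRing_of_isAffineOpen P U hUa
    have := functionField_isFractionRing_of_isAffineOpen C (φ ⁻¹ᵁ U) (hUa.preimage φ)
    let : Algebra Γ(P, U) C.functionField :=
      ((algebraMap Γ(C, φ ⁻¹ᵁ U) C.functionField).comp
        (algebraMap Γ(P, U) Γ(C, φ ⁻¹ᵁ U))).toAlgebra
    have t1 : IsScalarTower Γ(P, U) Γ(C, φ ⁻¹ᵁ U) C.functionField :=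
      IsScalarTower.of_algebraMap_eq fun _ => rfl
    have t2 : IsScalarTower Γ(P, U) P.functionField C.functionField :=
      IsScalarTower.of_algebraMap_eq fun r => (germ_stalkMapOver φ hgen U _ _ r).symm
    have hinj : Function.Injective (algebraMap Γ(P, U) Γ(C, φ ⁻¹ᵁ U)) := by
      have h : Function.Injective (algebraMap Γ(P, U) C.functionField) := by
        rw [IsScalarTower.algebraMap_eq Γ(P, U) P.functionField C.functionField]
        exact (algebraMap P.functionField C.functionField).injective.comp
          (IsFractionRing.injective Γ(P, U) P.functionField)
      rw [IsScalarTower.algebraMap_eq Γ(P, U) Γ(C, φ ⁻¹ᵁ U) C.functionField,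
        RingHom.coe_comp] at h
      exact h.of_comp
    have : FaithfulSMul Γ(P, U) Γ(C, φ ⁻¹ᵁ U) :=
      (faithfulSMul_iff_algebraMap_injective _ _).mpr hinj
    have : Module.Free Γ(P, U) Γ(C, φ ⁻¹ᵁ U) := Module.free_of_finite_type_torsion_free'
    refine ⟨Module.Finite.of_isLocalization Γ(P, U) Γ(C, φ ⁻¹ᵁ U) (nonZeroDivisors Γ(P, U)),
      fun a => ?_⟩
    exact Algebra.norm_localization Γ(P, U) (nonZeroDivisors Γ(P, U)) a
  have hne {V : P.Opens} {p : P} (hp : p ∈ V) : Nonempty V ∧ Nonempty (φ ⁻¹ᵁ V) := by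
    refine ⟨⟨⟨p, hp⟩⟩, ⟨⟨genericPoint C, ?_⟩⟩⟩
    change φ (genericPoint C) ∈ V
    rw [hgen]
    exact (genericPoint_specializes p).mem_open V.isOpen hp
  have hnorm {h : C.functionField} (hh : h ≠ 0) : Algebra.norm P.functionField h ≠ 0 := by
    obtain ⟨U, hpU, hUa, hUp⟩ := hU (genericPoint P)
    obtain ⟨_, _⟩ := hne hpU
    have := (loc U hUa hUp).1
    exact Algebra.norm_ne_zero_iff.mpr hh
  refine ⟨Algebra.norm P.functionField f, hnorm hf, ?_⟩
  ext p
  -- at the generic point both sides vanish, as orders are taken in codimension one only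
  by_cases hp : p = genericPoint P
  · have : Finite {x : C // φ x = p} := φ.finite_preimage_singleton p
    let : Fintype {x : C // φ x = p} := Fintype.ofFinite _
    have hcl (x : C) (hx : φ x = p) : ¬ IsClosed ({x} : Set C) := fun h => by
      have h1 : IsClosed ({φ x} : Set P) := by simpa using φ.isClosedMap _ h
      exact ne_genericPoint_of_isClosed hP h1 (hx.trans hp)
    rw [cycleMap_apply, principalCycle_apply, Scheme.ord_eq_zero_of_coheight_neq_one]
    · refine Finset.sum_eq_zero fun i _ => ?_
      rw [principalCycle_apply, Scheme.ord_eq_zero_of_coheight_neq_one, zero_mul]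
      exact fun h => hcl i.1 i.2 (isClosed_singleton_of_coheight_eq_one hC.le h)
    · exact fun h => ne_genericPoint_of_isClosed hP
        (isClosed_singleton_of_coheight_eq_one hP.le h) hp
  · have hpc := isClosed_singleton_of_ne_genericPoint hP hp
    obtain ⟨U, hpU, hUa, hUp⟩ := hU p
    obtain ⟨_, _⟩ := hne hpU
    have := functionField_isFractionRing_of_isAffineOpen C (φ ⁻¹ᵁ U) (hUa.preimage φ)
    obtain ⟨a, b, hb, hab⟩ := IsFractionRing.div_surjective (A := Γ(C, φ ⁻¹ᵁ U)) f
    have hb0 : b ≠ 0 := nonZeroDivisors.ne_zero hb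
    have hK (c : Γ(C, φ ⁻¹ᵁ U)) (hc : c ≠ 0) : C.germToFunctionField (φ ⁻¹ᵁ U) c ≠ 0 := by
      rw [Ne, map_eq_zero_iff _ (Scheme.germToFunctionField_injective C (φ ⁻¹ᵁ U))]
      exact hc
    have ha0 : a ≠ 0 := by
      rintro rfl
      rw [map_zero, zero_div] at hab
      exact hf hab.symm
    -- the claim is multiplicative, and `f = a / b` with `a`, `b` regular over `U`
    have h1 : f * C.germToFunctionField (φ ⁻¹ᵁ U) b = C.germToFunctionField (φ ⁻¹ᵁ U) a := by
      rw [← hab]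
      exact div_mul_cancel₀ _ (hK b hb0)
    have h2 (c : Γ(C, φ ⁻¹ᵁ U)) (hc : c ≠ 0) :
        cycleMap φ (principalCycle C (C.germToFunctionField (φ ⁻¹ᵁ U) c)) p =
          principalCycle P (Algebra.norm P.functionField
            (C.germToFunctionField (φ ⁻¹ᵁ U) c)) p := by
      rw [(loc U hUa hUp).2 c]
      exact ord_norm_eq_cycleMap φ hC hP U hUa p hpU hpc c hc
    have h3 := h2 a ha0
    rw [← h1, map_mul, principalCycle_mul hf (hK b hb0),
      principalCycle_mul (hnorm hf) (hnorm (hK b hb0)), map_add, Finsupp.add_apply,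
      Finsupp.add_apply, h2 b hb0] at h3
    exact add_right_cancel h3

end Norm

/-! ### Affine charts and the function field -/

section Chart

variable {P : Scheme.{u}} {R : CommRingCat.{u}} (j : Spec R ⟶ P) [IsOpenImmersion j]

instance isPrime_asIdeal_Spec {R : CommRingCat.{u}} (y : Spec R) : y.asIdeal.IsPrime :=
  PrimeSpectrum.isPrime y

/-- A function on the spectrum of `R`, as an element of the local ring at `y`. -/
def toSpecStalk (R : CommRingCat.{u}) (y : Spec R) :
    R ⟶ (Spec R).presheaf.stalk y :=
  (Scheme.ΓSpecIso R).inv ≫ (Spec R).presheaf.germ ⊤ y trivial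

theorem isLocalization_toSpecStalk (R : CommRingCat.{u}) (y : Spec R) :
    letI : Algebra R ((Spec R).presheaf.stalk y) := (toSpecStalk R y).hom.toAlgebra
    IsLocalization.AtPrime ((Spec R).presheaf.stalk y) y.asIdeal :=
  StructureSheaf.IsLocalization.to_stalk (R) y

/-- A function on an affine chart, as an element of the local ring at a point of the chart. -/
def chartToStalk (y : Spec R) : R ⟶ P.presheaf.stalk (j y) :=
  toSpecStalk R y ≫ inv (j.stalkMap y)

theorem chartToStalk_stalkMap (y : Spec R) (a : R) :
    (j.stalkMap y).hom ((chartToStalk j y).hom a) = (toSpecStalk R y).hom a := by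
  rw [← CommRingCat.comp_apply, chartToStalk, Category.assoc, IsIso.inv_hom_id, Category.comp_id]

theorem SpecMap_chartToStalk (y : Spec R) :
    Spec.map (chartToStalk j y) ≫ j = P.fromSpecStalk (j y) := by
  have h : Spec.map (toSpecStalk R y) = (Spec R).fromSpecStalk y :=
    (Spec.fromSpecStalk_eq _ y).symm
  rw [chartToStalk, Spec.map_comp, Category.assoc, h,
    ← Scheme.SpecMap_stalkMap_fromSpecStalk, ← Spec.map_comp_assoc, IsIso.hom_inv_id, Spec.map_id,
    Category.id_comp]

/-- The local ring at a point of an affine chart is the localisation at the corresponding prime. -/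
theorem isLocalization_chartToStalk (y : Spec R) :
    letI : Algebra R (P.presheaf.stalk (j y)) := (chartToStalk j y).hom.toAlgebra
    IsLocalization.AtPrime (P.presheaf.stalk (j y)) y.asIdeal := by
  let : Algebra R (P.presheaf.stalk (j y)) := (chartToStalk j y).hom.toAlgebra
  let : Algebra R ((Spec R).presheaf.stalk y) := (toSpecStalk R y).hom.toAlgebra
  have := isLocalization_toSpecStalk R y
  let e := (asIso (j.stalkMap y)).commRingCatIsoToRingEquiv
  let e' : (Spec R).presheaf.stalk y ≃ₐ[R] P.presheaf.stalk (j y) :=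
    AlgEquiv.symm (AlgEquiv.ofRingEquiv (f := e) fun r => chartToStalk_stalkMap j y r)
  exact IsLocalization.isLocalization_of_algEquiv y.asIdeal.primeCompl e'

theorem isUnit_chartToStalk_iff (y : Spec R) (a : R) :
    IsUnit ((chartToStalk j y).hom a) ↔ a ∉ y.asIdeal := by
  let : Algebra R (P.presheaf.stalk (j y)) := (chartToStalk j y).hom.toAlgebra
  have := isLocalization_chartToStalk j y
  exact IsLocalization.AtPrime.isUnit_to_map_iff (P.presheaf.stalk (j y)) y.asIdeal a

theorem isDomain_stalk_of_chart [IsDomain R] (y : Spec R) :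
    IsDomain (P.presheaf.stalk (j y)) := by
  let : Algebra R (P.presheaf.stalk (j y)) := (chartToStalk j y).hom.toAlgebra
  have := isLocalization_chartToStalk j y
  exact IsLocalization.isDomain_of_le_nonZeroDivisors (P.presheaf.stalk (j y))
    y.asIdeal.primeCompl_le_nonZeroDivisors

theorem isIntegrallyClosed_stalk_of_chart [IsDomain R] [IsIntegrallyClosed R] (y : Spec R) :
    IsIntegrallyClosed (P.presheaf.stalk (j y)) := by
  let : Algebra R (P.presheaf.stalk (j y)) := (chartToStalk j y).hom.toAlgebra
  have := isLocalization_chartToStalk j y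
  have := isDomain_stalk_of_chart j y
  exact isIntegrallyClosed_of_isLocalization _ y.asIdeal.primeCompl
    y.asIdeal.primeCompl_le_nonZeroDivisors

variable [IsIntegral P]

/-- Functions on an affine chart, as rational functions. The point of the chart used in the
definition does not matter, by `eq_chartToFunctionField`. -/
def chartToFunctionField [Nonempty (Spec R)] : R ⟶ P.functionField :=
  chartToStalk j (Classical.arbitrary _) ≫
    P.presheaf.stalkSpecializes (genericPoint_specializes _)

theorem SpecMap_chartToFunctionField [Nonempty (Spec R)] :
    Spec.map (chartToFunctionField j) ≫ j = P.fromSpecStalk (genericPoint P) := by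
  rw [chartToFunctionField, Spec.map_comp, Category.assoc, SpecMap_chartToStalk,
    Scheme.SpecMap_stalkSpecializes_fromSpecStalk]

/-- The identification of functions on a chart with rational functions is characterised by its
compatibility with the generic point. -/
theorem eq_chartToFunctionField [Nonempty (Spec R)] {e : R ⟶ P.functionField}
    (he : Spec.map e ≫ j = P.fromSpecStalk (genericPoint P)) : e = chartToFunctionField j := by
  apply Spec.map_injective
  rw [← cancel_mono j, he, SpecMap_chartToFunctionField]

theorem algebraMap_chartToStalk (y : Spec R) (a : R) :
    haveI : Nonempty (Spec R) := ⟨y⟩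
    algebraMap (P.presheaf.stalk (j y)) P.functionField ((chartToStalk j y).hom a) =
      (chartToFunctionField j).hom a := by
  have : Nonempty (Spec R) := ⟨y⟩
  rw [← eq_chartToFunctionField j (e := chartToStalk j y ≫
    P.presheaf.stalkSpecializes (genericPoint_specializes _))]
  · rfl
  · rw [Spec.map_comp, Category.assoc, SpecMap_chartToStalk,
      Scheme.SpecMap_stalkSpecializes_fromSpecStalk]

theorem chartToFunctionField_injective [IsDomain R] [Nonempty (Spec R)] :
    Function.Injective (chartToFunctionField j).hom := by
  let y : Spec R := Classical.arbitrary _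
  let : Algebra R (P.presheaf.stalk (j y)) := (chartToStalk j y).hom.toAlgebra
  have := isLocalization_chartToStalk j y
  have h : Function.Injective (algebraMap (P.presheaf.stalk (j y)) P.functionField ∘
      algebraMap R (P.presheaf.stalk (j y))) :=
    (IsFractionRing.injective (P.presheaf.stalk (j y)) P.functionField).comp
      (IsLocalization.injective _ y.asIdeal.primeCompl_le_nonZeroDivisors)
  exact h

/-- Rational functions are fractions of functions on any chart. -/
theorem exists_chartToFunctionField_mul_eq [IsDomain R] [Nonempty (Spec R)]
    (f : P.functionField) : ∃ a b : R, b ≠ 0 ∧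
      f * (chartToFunctionField j).hom b = (chartToFunctionField j).hom a := by
  let y : Spec R := Classical.arbitrary _
  let : Algebra R (P.presheaf.stalk (j y)) := (chartToStalk j y).hom.toAlgebra
  have := isLocalization_chartToStalk j y
  let e := (chartToFunctionField j).hom
  have he (r : R) : algebraMap (P.presheaf.stalk (j y)) P.functionField
      (algebraMap R (P.presheaf.stalk (j y)) r) = e r := algebraMap_chartToStalk j y r
  obtain ⟨s, t, ht, rfl⟩ := IsFractionRing.div_surjective (A := P.presheaf.stalk (j y)) f
  have ht0 : algebraMap (P.presheaf.stalk (j y)) P.functionField t ≠ 0 :=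
    IsFractionRing.to_map_ne_zero_of_mem_nonZeroDivisors ht
  obtain ⟨⟨a, c⟩, hac⟩ := IsLocalization.surj y.asIdeal.primeCompl s
  obtain ⟨⟨b, d⟩, hbd⟩ := IsLocalization.surj y.asIdeal.primeCompl t
  have hac' := congrArg (algebraMap (P.presheaf.stalk (j y)) P.functionField) hac
  have hbd' := congrArg (algebraMap (P.presheaf.stalk (j y)) P.functionField) hbd
  rw [map_mul, he, he] at hac' hbd'
  have hne (c : y.asIdeal.primeCompl) : (c : R) ≠ 0 := fun h => c.2 (h ▸ y.asIdeal.zero_mem)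
  have hinj := chartToFunctionField_injective j
  have hb0 : b ≠ 0 := by
    rintro rfl
    rw [map_zero] at hbd'
    exact mul_ne_zero ht0 (fun h => hne d (hinj (h.trans (map_zero e).symm))) hbd'
  refine ⟨a * d, b * c, mul_ne_zero hb0 (hne c), ?_⟩
  change _ * e _ = e _
  rw [map_mul, map_mul, ← hac', ← hbd']
  field_simp

variable [IsLocallyNoetherian P]

theorem ord_chartToFunctionField_of_notMem [Nonempty (Spec R)] {y : Spec R} {a : R}
    (ha : a ∉ y.asIdeal) : Scheme.ord ((chartToFunctionField j).hom a) (j y) = 0 := by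
  rw [← algebraMap_chartToStalk j y]
  exact ord_algebraMap_unit ((isUnit_chartToStalk_iff j y a).mpr ha)

/-- A generator of the prime of a point of codimension one has order one there. -/
theorem ord_chartToFunctionField_of_span_eq [IsDomain R] [Nonempty (Spec R)]
    {y : Spec R} (hy : Order.coheight (j y) = 1) {a : R}
    (ha0 : a ≠ 0) (ha : y.asIdeal = Ideal.span {a}) :
    Scheme.ord ((chartToFunctionField j).hom a) (j y) = 1 := by
  let : Algebra R (P.presheaf.stalk (j y)) := (chartToStalk j y).hom.toAlgebra
  have := isLocalization_chartToStalk j y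
  have h0 : (chartToStalk j y).hom a ≠ 0 := by
    have hinj := IsLocalization.injective (P.presheaf.stalk (j y))
      y.asIdeal.primeCompl_le_nonZeroDivisors
    intro h
    exact ha0 (hinj (h.trans (map_zero _).symm))
  obtain ⟨n, hn, hn'⟩ := exists_ord_algebraMap_eq hy h0
  rw [← algebraMap_chartToStalk j y a, hn']
  have h1 : Ideal.span {(chartToStalk j y).hom a} =
      IsLocalRing.maximalIdeal (P.presheaf.stalk (j y)) := by
    rw [← IsLocalization.AtPrime.map_eq_maximalIdeal y.asIdeal, ha, Ideal.map_span,
      Set.image_singleton]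
    rfl
  have h2 : Ring.ord (P.presheaf.stalk (j y)) ((chartToStalk j y).hom a) = 1 := by
    rw [Ring.ord, h1, Module.length_eq_one_iff]
    exact isSimpleModule_iff_quot_maximal.mpr
      ⟨_, IsLocalRing.maximalIdeal.isMaximal _, ⟨LinearEquiv.refl _ _⟩⟩
  rw [h2] at hn
  exact_mod_cast hn.symm

end Chart

/-! ### Schemes covered by two affine lines glued along inversion -/

section ProjectiveLineCharts

open Polynomial

/-- The standard charts of a projective line `π : P ⟶ Spec F`: two affine lines covering `P`,
whose coordinates are inverse to each other on the overlap. The data are phrased so that they pass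
to base changes of `π`. -/
structure ProjectiveLineCharts {F : Type u} [Field F] {P : Scheme.{u}} (π : P ⟶ Spec (.of F)) where
  /-- The chart around the point `0`. -/
  zero : Spec (.of F[X]) ⟶ P
  /-- The chart around the point `∞`. -/
  infty : Spec (.of F[X]) ⟶ P
  [isOpenImmersion_zero : IsOpenImmersion zero]
  [isOpenImmersion_infty : IsOpenImmersion infty]
  zero_comp : zero ≫ π = Spec.map (CommRingCat.ofHom C)
  infty_comp : infty ≫ π = Spec.map (CommRingCat.ofHom C)
  cover : ∀ p, p ∈ Set.range zero ∨ p ∈ Set.range infty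
  /-- The overlap of the charts is the locus where the coordinate at `∞` is invertible. -/
  mem_range_zero_iff : ∀ z : Spec (.of F[X]), infty z ∈ Set.range zero ↔ (X : F[X]) ∉ z.asIdeal
  /-- The gluing, on `R`-valued points: the point with coordinate `v` in one chart has coordinate
  `v⁻¹` in the other. -/
  overlap : ∀ (R : Type u) [CommRing R] (σ : F →+* R) (v : Rˣ),
    Spec.map (CommRingCat.ofHom (eval₂RingHom σ (v : R))) ≫ zero =
      Spec.map (CommRingCat.ofHom (eval₂RingHom σ ((v⁻¹ : Rˣ) : R))) ≫ infty

attribute [instance] ProjectiveLineCharts.isOpenImmersion_zero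
  ProjectiveLineCharts.isOpenImmersion_infty

namespace ProjectiveLineCharts

variable {F : Type u} [Field F] {P : Scheme.{u}} {π : P ⟶ Spec (.of F)}
  (c : ProjectiveLineCharts π)

instance : IsDomain (CommRingCat.of F[X]) := inferInstanceAs (IsDomain F[X])

instance : IsPrincipalIdealRing (CommRingCat.of F[X]) :=
  inferInstanceAs (IsPrincipalIdealRing F[X])

/-- The point `∞`. -/
def inftyPoint : P :=
  c.infty (⟨Ideal.span {X}, (Ideal.span_singleton_prime X_ne_zero).mpr prime_X⟩ :
    PrimeSpectrum F[X])

include c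

theorem eq_inftyPoint {p : P} (hp : p ∉ Set.range c.zero) : p = c.inftyPoint := by
  obtain ⟨z, rfl⟩ := (c.cover p).resolve_left hp
  have hz : (X : F[X]) ∈ z.asIdeal := by
    by_contra h
    exact hp ((c.mem_range_zero_iff z).mpr h)
  have : (Ideal.span {(X : F[X])}).IsMaximal :=
    PrincipalIdealRing.isMaximal_of_irreducible irreducible_X
  have h1 : Ideal.span {(X : F[X])} = z.asIdeal :=
    this.eq_of_le (PrimeSpectrum.isPrime z).ne_top
      ((Ideal.span_singleton_le_iff_mem _).mpr hz)
  exact congrArg c.infty (PrimeSpectrum.ext h1.symm)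

theorem inftyPoint_notMem : c.inftyPoint ∉ Set.range c.zero := fun h =>
  (c.mem_range_zero_iff _).mp h (Ideal.mem_span_singleton_self X)

theorem isClosed_inftyPoint : IsClosed ({c.inftyPoint} : Set P) := by
  have h : ({c.inftyPoint} : Set P) = (Set.range c.zero)ᶜ := by
    ext p
    refine ⟨?_, fun hp => c.eq_inftyPoint hp⟩
    rintro rfl
    exact c.inftyPoint_notMem
  rw [h]
  exact c.zero.isOpenEmbedding.isOpen_range.isClosed_compl

/-- The generic point of the chart at `0` lies in both charts, hence is generic in `P`. -/
theorem exists_specializes : ∃ η : P, ∀ p : P, η ⤳ p := by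
  let b : Spec (.of F[X]) := (⊥ : PrimeSpectrum F[X])
  have hb (y : Spec (.of F[X])) : b ⤳ y :=
    (PrimeSpectrum.le_iff_specializes (⊥ : PrimeSpectrum F[X]) y).mp bot_le
  refine ⟨c.zero b, fun p => ?_⟩
  rcases c.cover p with ⟨y, rfl⟩ | ⟨y, rfl⟩
  · exact (hb y).map c.zero.continuous
  · obtain ⟨w, hw⟩ := (c.mem_range_zero_iff b).mpr (fun h => X_ne_zero h)
    have h1 := (hb w).map c.zero.continuous
    rw [hw] at h1
    exact h1.trans ((hb y).map c.infty.continuous)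

theorem isIntegral : IsIntegral P := by
  have : IrreducibleSpace P := by
    obtain ⟨η, hη⟩ := c.exists_specializes
    have h : closure {η} = (Set.univ : Set P) :=
      Set.eq_univ_of_forall fun p => (hη p).mem_closure
    have h' : IsIrreducible (closure {η}) := isIrreducible_singleton.closure
    rw [h] at h'
    exact (irreducibleSpace_def P).mpr h'
  have hred (p : P) : _root_.IsReduced (P.presheaf.stalk p) := by
    rcases c.cover p with ⟨y, rfl⟩ | ⟨y, rfl⟩
    · have := isDomain_stalk_of_chart c.zero y
      infer_instance
    · have := isDomain_stalk_of_chart c.infty y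
      infer_instance
  have := isReduced_of_isReduced_stalk P
  exact isIntegral_of_irreducibleSpace_of_isReduced P

theorem isIntegrallyClosed_stalk (p : P) : IsIntegrallyClosed (P.presheaf.stalk p) := by
  have : IsIntegrallyClosed (CommRingCat.of F[X]) := inferInstanceAs (IsIntegrallyClosed F[X])
  rcases c.cover p with ⟨y, rfl⟩ | ⟨y, rfl⟩
  · exact isIntegrallyClosed_stalk_of_chart c.zero y
  · exact isIntegrallyClosed_stalk_of_chart c.infty y

/-- Locally, `P` is the spectrum of a principal ideal domain. -/
theorem exists_isAffineOpen (p : P) : ∃ U : P.Opens, p ∈ U ∧ IsAffineOpen U ∧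
    IsPrincipalIdealRing Γ(P, U) := by
  have key (j : Spec (.of F[X]) ⟶ P) [IsOpenImmersion j] (y : Spec (.of F[X])) :
      ∃ U : P.Opens, j y ∈ U ∧ IsAffineOpen U ∧ IsPrincipalIdealRing Γ(P, U) := by
    refine ⟨j ''ᵁ ⊤, ⟨y, trivial, rfl⟩, (isAffineOpen_top _).image_of_isOpenImmersion j, ?_⟩
    let e := ((Scheme.ΓSpecIso (.of F[X])).symm ≪≫ (j.appIso ⊤).symm).commRingCatIsoToRingEquiv
    exact IsPrincipalIdealRing.of_surjective e.toRingHom e.surjective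
  rcases c.cover p with ⟨y, rfl⟩ | ⟨y, rfl⟩
  · exact key _ y
  · exact key _ y

theorem isNoetherian : IsNoetherian P := by
  have h1 : IsLocallyNoetherian P := by
    choose U hpU hU hPID using c.exists_isAffineOpen
    refine isLocallyNoetherian_of_affine_cover (S := fun p => ⟨U p, hU p⟩) ?_ ?_
    · exact top_le_iff.mp fun p _ => TopologicalSpace.Opens.mem_iSup.mpr ⟨p, hpU p⟩
    · intro p
      have := hPID p
      change IsNoetherianRing Γ(P, U p)
      infer_instance
  have h2 : CompactSpace P := by
    refine ⟨?_⟩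
    have : (Set.univ : Set P) = Set.range c.zero ∪ Set.range c.infty :=
      (Set.eq_univ_of_forall c.cover).symm
    rw [this]
    exact (isCompact_range c.zero.continuous).union (isCompact_range c.infty.continuous)
  exact {}

theorem topologicalKrullDim_eq_one : topologicalKrullDim P = 1 := by
  have := c.isIntegral
  have hR : topologicalKrullDim (Spec (.of F[X])) ≤ 1 := by
    refine (PrimeSpectrum.topologicalKrullDim_eq_ringKrullDim F[X]).le.trans ?_
    rw [IsPrincipalIdealRing.ringKrullDim_eq_one F[X] (Polynomial.not_isField F)]
  have key (j : Spec (.of F[X]) ⟶ P) [IsOpenImmersion j] (y : Spec (.of F[X])) :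
      (Order.coheight (j y) : WithBot ℕ∞) ≤ 1 := by
    have h : Order.coheight (j y) = Order.coheight y := coheight_eq_of_isOpenImmersion j
    rw [h]
    exact (coheight_le_topologicalKrullDim y).trans hR
  apply le_antisymm
  · rw [topologicalKrullDim, Order.krullDim_eq_of_orderIso (irreducibleSetEquivPoints (α := P)),
      Order.krullDim_eq_iSup_coheight_of_nonempty]
    have : (⨆ p : P, Order.coheight p) ≤ 1 := iSup_le fun p => by
      rcases c.cover p with ⟨y, rfl⟩ | ⟨y, rfl⟩
      · exact_mod_cast key c.zero y
      · exact_mod_cast key c.infty y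
    exact_mod_cast this
  · refine le_trans ?_ (coheight_le_topologicalKrullDim c.inftyPoint)
    have hne : c.inftyPoint ≠ genericPoint P := by
      intro h
      apply c.inftyPoint_notMem
      rw [h]
      obtain ⟨y⟩ : Nonempty (Spec (.of F[X])) := inferInstance
      exact (genericPoint_specializes (c.zero y)).mem_open
        c.zero.isOpenEmbedding.isOpen_range ⟨y, rfl⟩
    have hlt : c.inftyPoint < genericPoint P := ⟨genericPoint_specializes _, fun h =>
      hne ((genericPoint_specializes _).antisymm (Scheme.le_iff_specializes.mp h)).eq.symm⟩
    have : (1 : ℕ∞) ≤ Order.coheight c.inftyPoint :=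
      le_trans (by simp) (Order.coheight_add_one_le hlt)
    exact_mod_cast this

end ProjectiveLineCharts

end ProjectiveLineCharts

/-! ### Zero-cycles on a projective line -/

section ProjectiveLineCycles

open Polynomial

theorem cycleMap_id {X : Scheme.{u}} (z : X →₀ ℤ) : cycleMap (𝟙 X) z = z := by
  induction z using Finsupp.induction_linear with
  | zero => simp
  | add a b ha hb => simp [ha, hb]
  | single x n =>
    rw [cycleMap_single, Scheme.Hom.residueDegree_id, Nat.cast_one, one_mul]
    rfl

theorem toSpecStalk_stalkMap {R S : CommRingCat.{u}} (g : R ⟶ S) (y : Spec S) (r : R) :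
    ((Spec.map g).stalkMap y).hom ((toSpecStalk R (Spec.map g y)).hom r) =
      (toSpecStalk S y).hom (g.hom r) := by
  have h : g ≫ toSpecStalk S y = toSpecStalk R (Spec.map g y) ≫ (Spec.map g).stalkMap y := by
    have hg := Scheme.Hom.germ_stalkMap (Spec.map g) ⊤ y trivial
    exact (Scheme.ΓSpecIso_inv_naturality_assoc g _).trans
      ((congrArg ((Scheme.ΓSpecIso R).inv ≫ ·) hg.symm).trans (Category.assoc _ _ _).symm)
  exact congr($(h.symm) r)

variable {F : Type u} [Field F]

/-- The closed point of the affine line cut out by the irreducible polynomial `q`. -/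
def pointOf (q : F[X]) (hq : Irreducible q) : Spec (.of F[X]) :=
  (⟨Ideal.span {q}, (Ideal.span_singleton_prime hq.ne_zero).mpr hq.prime⟩ : PrimeSpectrum F[X])

theorem exists_eq_pointOf {y : Spec (.of F[X])} (hy : IsClosed ({y} : Set (Spec (.of F[X])))) :
    ∃ (q : F[X]) (hq : Irreducible q), y = pointOf q hq := by
  have hmax : (PrimeSpectrum.asIdeal y : Ideal F[X]).IsMaximal :=
    (PrimeSpectrum.isClosed_singleton_iff_isMaximal (R := F[X]) y).mp hy
  obtain ⟨q, hq⟩ := IsPrincipalIdealRing.principal (PrimeSpectrum.asIdeal y : Ideal F[X])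
  have hq0 : q ≠ 0 := by
    rintro rfl
    refine Ring.ne_bot_of_isMaximal_of_not_isField hmax (Polynomial.not_isField F) ?_
    rw [hq]
    exact Submodule.span_zero_singleton _
  have hq' : (PrimeSpectrum.asIdeal y : Ideal F[X]) = Ideal.span {q} := hq
  have hprime : Prime q := by
    rw [← Ideal.span_singleton_prime hq0, ← hq']
    exact PrimeSpectrum.isPrime y
  exact ⟨q, hprime.irreducible, PrimeSpectrum.ext hq'⟩

/-- The residue field of the affine line at `q` is `F[X] ⧸ q`. -/
theorem residueDegree_SpecMap_C {q : F[X]} (hq : Irreducible q) :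
    (Spec.map (CommRingCat.ofHom (C : F →+* F[X]))).residueDegree (pointOf q hq) =
      q.natDegree := by
  let φ := Spec.map (CommRingCat.ofHom (C : F →+* F[X]))
  let y := pointOf q hq
  have hmax : (Ideal.span {q}).IsMaximal := PrincipalIdealRing.isMaximal_of_irreducible hq
  let A := (Spec (.of F)).presheaf.stalk (φ y)
  let B := (Spec (.of F[X])).presheaf.stalk y
  let : Algebra F A := (toSpecStalk (.of F) (φ y)).hom.toAlgebra
  let : Algebra F[X] B := (toSpecStalk (.of F[X]) y).hom.toAlgebra
  let s : PrimeSpectrum F := φ y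
  have locA : IsLocalization.AtPrime A s.asIdeal := isLocalization_toSpecStalk (.of F) (φ y)
  have locB : IsLocalization.AtPrime B (Ideal.span {q}) := isLocalization_toSpecStalk (.of F[X]) y
  have hmaxA : s.asIdeal.IsMaximal := by
    rw [Ideal.eq_bot_of_prime s.asIdeal]
    exact Ideal.bot_isMaximal
  let algF := (φ.residueFieldMap y).hom.toAlgebra
  let i : F ≃+* (Spec (.of F)).residueField (φ y) :=
    RingEquiv.ofBijective ((IsLocalRing.residue A).comp (algebraMap F A))
      ⟨RingHom.injective _, fun x => by
        obtain ⟨x, rfl⟩ := (quotientEquivResidueField s.asIdeal A).surjective x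
        obtain ⟨r, rfl⟩ := Ideal.Quotient.mk_surjective x
        exact ⟨r, rfl⟩⟩
  let j : (F[X] ⧸ Ideal.span {q}) ≃+* (Spec (.of F[X])).residueField y :=
    IsLocalization.AtPrime.equivQuotMaximalIdeal (Ideal.span {q}) B
  rw [← finrank_quotient_span_eq_natDegree]
  refine (Algebra.finrank_eq_of_equiv_equiv i j ?_).symm
  ext r
  change IsLocalRing.residue B ((φ.stalkMap y).hom ((toSpecStalk (.of F) (φ y)).hom r)) =
    IsLocalRing.residue B ((toSpecStalk (.of F[X]) y).hom (C r))
  congr 1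
  exact toSpecStalk_stalkMap _ _ _

theorem residueDegree_of_chart {P : Scheme.{u}} {π : P ⟶ Spec (.of F)}
    {j : Spec (.of F[X]) ⟶ P} [IsOpenImmersion j]
    (hj : j ≫ π = Spec.map (CommRingCat.ofHom C)) {q : F[X]} (hq : Irreducible q) :
    π.residueDegree (j (pointOf q hq)) = q.natDegree := by
  have h1 := residueDegree_comp j π (pointOf q hq)
  rw [residueDegree_eq_one j, mul_one, hj] at h1
  rw [← h1, residueDegree_SpecMap_C hq]

namespace ProjectiveLineCharts

variable {P : Scheme.{u}} {π : P ⟶ Spec (.of F)}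
  (c : ProjectiveLineCharts π) [IsIntegral P]

instance : Nonempty (Spec (.of F[X])) := inferInstanceAs (Nonempty (PrimeSpectrum F[X]))

/-- A polynomial in the coordinate at `0`, as a rational function. -/
def zeroFun : F[X] →+* P.functionField := (chartToFunctionField c.zero).hom

/-- A polynomial in the coordinate at `∞`, as a rational function. -/
def inftyFun : F[X] →+* P.functionField := (chartToFunctionField c.infty).hom

theorem zeroFun_injective : Function.Injective c.zeroFun :=
  chartToFunctionField_injective c.zero

theorem zeroFun_ne_zero {q : F[X]} (hq : q ≠ 0) : c.zeroFun q ≠ 0 :=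
  (map_ne_zero_iff _ c.zeroFun_injective).mpr hq

/-- The coordinate at `∞` is the inverse of the coordinate at `0`, as rational functions. -/
theorem inftyFun_eq : c.inftyFun =
    eval₂RingHom (c.zeroFun.comp C) (c.zeroFun X)⁻¹ := by
  have h1 : c.zeroFun = eval₂RingHom (c.zeroFun.comp C)
      ((Units.mk0 _ (c.zeroFun_ne_zero X_ne_zero) : (P.functionField : Type u)ˣ) :
        P.functionField) := by
    ext <;> simp
  have h2 := c.overlap P.functionField (c.zeroFun.comp C)
    (Units.mk0 _ (c.zeroFun_ne_zero X_ne_zero))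
  rw [← h1] at h2
  have h3 := eq_chartToFunctionField c.infty (h2.symm.trans (SpecMap_chartToFunctionField c.zero))
  exact (congrArg CommRingCat.Hom.hom h3).symm

/-- With `s = t⁻¹`, one has `q(t) s ^ deg q = q.reverse(s)`. -/
theorem zeroFun_mul_pow (q : F[X]) :
    c.zeroFun q * c.inftyFun X ^ q.natDegree = c.inftyFun q.reverse := by
  have hX := c.zeroFun_ne_zero X_ne_zero
  let : Invertible (c.zeroFun X) := invertibleOfNonzero hX
  have h := eval₂_reverse_mul_pow (c.zeroFun.comp C) (c.zeroFun X) q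
  have h1 : eval₂ (c.zeroFun.comp C) (c.zeroFun X) q = c.zeroFun q :=
    congr($(show eval₂RingHom (c.zeroFun.comp C) (c.zeroFun X) = c.zeroFun by ext <;> simp) q)
  rw [h1] at h
  rw [c.inftyFun_eq, coe_eval₂RingHom, ← h, eval₂_X, mul_right_comm, mul_assoc, ← mul_pow,
    invOf_eq_inv, inv_mul_cancel₀ hX, one_pow, mul_one]

variable [IsNoetherian P]

/-- A polynomial of degree `n` has a pole of order `n` at `∞`, since the reverse polynomial has a
nonzero constant term. -/
theorem ord_zeroFun_inftyPoint {q : F[X]} (hq : q ≠ 0) :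
    Scheme.ord (c.zeroFun q) c.inftyPoint = -q.natDegree := by
  have hco := coheight_eq_one_of_isClosed c.topologicalKrullDim_eq_one c.isClosed_inftyPoint
  have h1 : Scheme.ord (c.inftyFun X) c.inftyPoint = 1 :=
    ord_chartToFunctionField_of_span_eq c.infty hco (a := (X : F[X])) X_ne_zero rfl
  have h2 : Scheme.ord (c.inftyFun q.reverse) c.inftyPoint = 0 := by
    refine ord_chartToFunctionField_of_notMem c.infty (a := q.reverse) fun h => ?_
    have h' : q.reverse ∈ Ideal.span {(X : F[X])} := h
    rw [Ideal.mem_span_singleton, X_dvd_iff, coeff_zero_reverse, leadingCoeff_eq_zero] at h'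
    exact hq h'
  have hX0 : c.inftyFun X ≠ 0 := by
    intro h
    rw [h, Scheme.ord_zero] at h1
    exact absurd h1 (by simp)
  have h3 (n : ℕ) : Scheme.ord (c.inftyFun X ^ n) c.inftyPoint = n := by
    induction n with
    | zero =>
      have h4 : c.inftyFun X ^ 0 = c.inftyFun 1 := by simp
      rw [h4]
      refine (ord_chartToFunctionField_of_notMem c.infty (a := (1 : F[X])) fun h => ?_).trans
        Nat.cast_zero.symm
      exact (PrimeSpectrum.isPrime _).ne_top ((Ideal.eq_top_iff_one _).mpr h)
    | succ n ih => rw [pow_succ, Scheme.ord_mul (pow_ne_zero n hX0) hX0, ih, h1, Nat.cast_succ]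
  have h5 := c.zeroFun_mul_pow q
  have h6 := Scheme.ord_mul (x := c.inftyPoint) (c.zeroFun_ne_zero hq)
    (pow_ne_zero q.natDegree hX0)
  rw [h5, h2, h3] at h6
  linarith

/-- The divisor of an irreducible polynomial `q` is `[q = 0] - deg q [∞]`. -/
theorem principalCycle_zeroFun {q : F[X]} (hq : Irreducible q) :
    principalCycle P (c.zeroFun q) = Finsupp.single (c.zero (pointOf q hq)) 1 +
      Finsupp.single c.inftyPoint (-q.natDegree : ℤ) := by
  have hdim := c.topologicalKrullDim_eq_one
  have hmax : (Ideal.span {q}).IsMaximal := PrincipalIdealRing.isMaximal_of_irreducible hq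
  have hnotMem (y : Spec (.of F[X])) : c.zero y ≠ c.inftyPoint := fun h =>
    c.inftyPoint_notMem ⟨y, h⟩
  have hne : c.zero (pointOf q hq) ≠ genericPoint P := by
    intro h
    have h1 : genericPoint (Spec (.of F[X])) = pointOf q hq :=
      c.zero.isOpenEmbedding.injective ((genericPoint_eq_of_isOpenImmersion c.zero).trans h.symm)
    rw [genericPoint_eq_bot_of_affine] at h1
    have h2 : q ∈ (⊥ : Ideal F[X]) := by
      have h3 : (⊥ : Ideal F[X]) = Ideal.span {q} := congrArg PrimeSpectrum.asIdeal h1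
      rw [h3]
      exact Ideal.mem_span_singleton_self q
    exact hq.ne_zero h2
  ext p
  rw [principalCycle_apply, Finsupp.add_apply]
  by_cases hp : p = genericPoint P
  · have h1 : c.inftyPoint ≠ p := fun h =>
      ne_genericPoint_of_isClosed hdim c.isClosed_inftyPoint (h.trans hp)
    rw [Finsupp.single_eq_of_ne (fun h => hne (h.symm.trans hp)), Finsupp.single_eq_of_ne h1.symm,
      Scheme.ord_eq_zero_of_coheight_neq_one, add_zero]
    exact fun h => ne_genericPoint_of_isClosed hdim
        (isClosed_singleton_of_coheight_eq_one hdim.le h) hp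
  · have hco := coheight_eq_one_of_isClosed hdim (isClosed_singleton_of_ne_genericPoint hdim hp)
    by_cases hpr : p ∈ Set.range c.zero
    · obtain ⟨y, rfl⟩ := hpr
      rw [Finsupp.single_eq_of_ne (hnotMem y), add_zero]
      by_cases hy : y = pointOf q hq
      · subst hy
        rw [Finsupp.single_eq_same]
        exact ord_chartToFunctionField_of_span_eq c.zero hco (a := q) hq.ne_zero rfl
      · rw [Finsupp.single_eq_of_ne fun h => hy (c.zero.isOpenEmbedding.injective h)]
        refine ord_chartToFunctionField_of_notMem c.zero (a := q) fun h => hy ?_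
        refine PrimeSpectrum.ext (hmax.eq_of_le (PrimeSpectrum.isPrime y).ne_top ?_).symm
        exact (Ideal.span_singleton_le_iff_mem _).mpr h
    · obtain rfl := c.eq_inftyPoint hpr
      rw [Finsupp.single_eq_same, Finsupp.single_eq_of_ne (hnotMem _).symm, zero_add,
        c.ord_zeroFun_inftyPoint hq.ne_zero]

theorem cycleDegree_zeroFun {q : F[X]} (hq : q ≠ 0) :
    cycleDegree π (principalCycle P (c.zeroFun q)) = 0 := by
  induction q using WfDvdMonoid.induction_on_irreducible with
  | zero => exact absurd rfl hq
  | unit q hu =>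
    have h : principalCycle P (c.zeroFun q) = 0 := by
      ext p
      rw [principalCycle_apply, Finsupp.zero_apply]
      by_cases hp : p ∈ Set.range c.zero
      · obtain ⟨y, rfl⟩ := hp
        refine ord_chartToFunctionField_of_notMem c.zero (a := q) fun h => ?_
        exact (PrimeSpectrum.isPrime y).ne_top (Ideal.eq_top_of_isUnit_mem _ h hu)
      · rw [c.eq_inftyPoint hp, c.ord_zeroFun_inftyPoint hq, natDegree_eq_zero_of_isUnit hu]
        rfl
    rw [h, map_zero]
  | mul a i ha hi ih =>
    rw [map_mul, principalCycle_mul (c.zeroFun_ne_zero hi.ne_zero) (c.zeroFun_ne_zero ha), map_add,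
      ih ha, add_zero, c.principalCycle_zeroFun hi, map_add, cycleDegree_single, cycleDegree_single,
      residueDegree_of_chart c.zero_comp hi,
      show c.inftyPoint = c.infty (pointOf X irreducible_X) from rfl,
      residueDegree_of_chart c.infty_comp irreducible_X, natDegree_X]
    simp

include c in
/-- The divisor of a rational function on a projective line has degree zero. -/
theorem cycleDegree_principalCycle {f : P.functionField} (hf : f ≠ 0) :
    cycleDegree π (principalCycle P f) = 0 := by
  obtain ⟨a, b, hb, hab⟩ := exists_chartToFunctionField_mul_eq c.zero f
  change f * c.zeroFun b = c.zeroFun a at hab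
  have ha : (a : F[X]) ≠ 0 := by
    rintro rfl
    rw [map_zero] at hab
    exact mul_ne_zero hf (c.zeroFun_ne_zero hb) hab
  have h := c.cycleDegree_zeroFun ha
  rwa [← hab, principalCycle_mul hf (c.zeroFun_ne_zero hb), map_add, c.cycleDegree_zeroFun hb,
    add_zero] at h

end ProjectiveLineCharts

/-- On a projective line the degree map identifies the Chow group of zero-cycles with `ℤ`. -/
theorem degreeInducesIso_of_projectiveLineCharts {P : Scheme.{u}}
    {π : P ⟶ Spec (.of F)} (c : ProjectiveLineCharts π) : DegreeInducesIso π ⊤ := by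
  have := c.isIntegral
  have := c.isNoetherian
  have hdim := c.topologicalKrullDim_eq_one
  have hnot (x : P) : x ∉ (⊤ : P.IdealSheafData).support := by
    rw [Scheme.IdealSheafData.support_top]
    exact id
  -- relations have degree zero: the push-forward of a principal divisor to `P` is principal
  have hrel (z : ZeroCycle P ⊤) (hz : z ∈ modulusRelations P ⊤) : degree π ⊤ z = 0 := by
    have hle : modulusRelations P ⊤ ≤ (degree π ⊤).ker := by
      rw [modulusRelations, AddSubgroup.closure_le]
      rintro _ ⟨W, f, hf, rfl⟩
      change degree π ⊤ _ = 0
      obtain ⟨g, hg, hfg⟩ := exists_cycleMap_principalCycle_eq W.φ W.dim_eq_one hdim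
        c.exists_isAffineOpen f.ne_zero
      rw [degree_eq_cycleDegree, toCycle_tau W hf, hfg, c.cycleDegree_principalCycle hg]
    exact hle hz
  let o : ClosedPointOff P ⊤ := ⟨c.inftyPoint, c.isClosed_inftyPoint, hnot _⟩
  have hdego : π.residueDegree c.inftyPoint = 1 :=
    (residueDegree_of_chart c.infty_comp irreducible_X).trans natDegree_X
  -- `P` itself is an admissible curve, and without a divisor there is no modulus condition
  let W : FiniteCurve P ⊤ :=
    { C := P
      φ := 𝟙 P
      isIntegral := inferInstance
      isNoetherian := inferInstance
      normal := c.isIntegrallyClosed_stalk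
      dim_eq_one := hdim
      isFinite := inferInstance
      not_subset := fun h => hnot c.inftyPoint (h ⟨c.inftyPoint, rfl⟩) }
  have hW (f : (P.functionField : Type u)ˣ) :
      f ∈ modulusGroup W.C ((⊤ : P.IdealSheafData).comap W.φ) := by
    rw [mem_modulusGroup_iff]
    intro z
    exfalso
    have hz : ((⊤ : P.IdealSheafData).comap W.φ).subschemeι z ∈
        ((⊤ : P.IdealSheafData).comap W.φ).support := by
      have h := Scheme.IdealSheafData.range_subschemeι ((⊤ : P.IdealSheafData).comap W.φ)
      have h2 : ((⊤ : P.IdealSheafData).comap W.φ).subschemeι z ∈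
        Set.range ((⊤ : P.IdealSheafData).comap W.φ).subschemeι := ⟨z, rfl⟩
      rw [h] at h2
      exact h2
    rw [Scheme.IdealSheafData.support_comap] at hz
    exact hnot _ hz
  -- every closed point is equivalent to a multiple of `∞`, by the divisor of its equation
  have hequiv (x : ClosedPointOff P ⊤) :
      Finsupp.single x 1 - Finsupp.single o (π.residueDegree x.1 : ℤ) ∈ modulusRelations P ⊤ := by
    by_cases hr : x.1 ∈ Set.range c.zero
    · obtain ⟨y, hy⟩ := hr
      have hyc : IsClosed ({y} : Set (Spec (.of F[X]))) := by
        have h := x.2.1.preimage c.zero.continuous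
        have h1 : (c.zero ⁻¹' {x.1} : Set (Spec (.of F[X]))) = {y} := by
          ext w
          exact ⟨fun h => c.zero.isOpenEmbedding.injective (h.trans hy.symm),
            fun h => (congrArg c.zero h).trans hy⟩
        rwa [h1] at h
      obtain ⟨q, hq, rfl⟩ := exists_eq_pointOf hyc
      have h := tau_mem_modulusRelations W (hW (Units.mk0 _ (c.zeroFun_ne_zero hq.ne_zero)))
      convert h
      apply toCycle_injective
      rw [toCycle_tau W (hW _)]
      refine Eq.trans ?_ (cycleMap_id (principalCycle P (c.zeroFun q))).symm
      rw [c.principalCycle_zeroFun hq, map_sub, toCycle_single, toCycle_single, ← hy,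
        residueDegree_of_chart c.zero_comp hq, Finsupp.single_neg, sub_eq_add_neg]
    · have hx : x = o := Subtype.ext (c.eq_inftyPoint hr)
      rw [hx, show o.1 = c.inftyPoint from rfl, hdego, Nat.cast_one, sub_self]
      exact zero_mem _
  have hequiv' (z : ZeroCycle P ⊤) :
      z - Finsupp.single o (degree π ⊤ z) ∈ modulusRelations P ⊤ := by
    induction z using Finsupp.induction_linear with
    | zero => simp
    | add a b ha hb =>
      rw [map_add, Finsupp.single_add, add_sub_add_comm]
      exact add_mem ha hb
    | single x n =>
      have h := AddSubgroup.zsmul_mem _ (hequiv x) n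
      convert h using 1
      rw [smul_sub, Finsupp.smul_single, Finsupp.smul_single, smul_eq_mul, smul_eq_mul, mul_one,
        degree_eq_cycleDegree, toCycle_single, cycleDegree_single, mul_comm]
  let d : CH0 P ⊤ →+ ℤ := QuotientAddGroup.lift (modulusRelations P ⊤) (degree π ⊤) hrel
  have hd (z : ZeroCycle P ⊤) : d (CH0.mk z) = degree π ⊤ z := rfl
  refine ⟨AddEquiv.ofBijective d ⟨?_, fun n => ⟨CH0.mk (Finsupp.single o n), ?_⟩⟩, hd⟩
  · rw [injective_iff_map_eq_zero]
    intro z hz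
    obtain ⟨z, rfl⟩ := QuotientAddGroup.mk'_surjective _ z
    have h := hequiv' z
    rw [show degree π ⊤ z = 0 from hz, Finsupp.single_zero, sub_zero] at h
    exact (QuotientAddGroup.eq_zero_iff z).mpr h
  · rw [hd, degree_eq_cycleDegree, toCycle_single, cycleDegree_single]
    change (π.residueDegree c.inftyPoint : ℤ) * n = n
    rw [hdego, Nat.cast_one, one_mul]

end ProjectiveLineCycles

/-! ### Base change of a projective line -/

section ChartsBaseChange

open Polynomial

attribute [local instance] Polynomial.algebra

variable {k : Type u} [Field k] {P : Scheme.{u}} {π : P ⟶ Spec (.of k)}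
  (K : Type u) [Field K] [Algebra k K]

/-- The affine line is stable under base change. -/
theorem isPullback_SpecMap_polynomial :
    IsPullback (Spec.map (CommRingCat.ofHom (mapRingHom (algebraMap k K))))
      (Spec.map (CommRingCat.ofHom (C : K →+* K[X])))
      (Spec.map (CommRingCat.ofHom (C : k →+* k[X])))
      (Spec.map (CommRingCat.ofHom (algebraMap k K))) :=
  isPullback_SpecMap_of_isPushout _ _ _ _ (CommRingCat.isPushout_of_isPushout k k[X] K K[X])

/-- The base change of an affine chart. -/
def chartBaseChange {j : Spec (.of k[X]) ⟶ P} (hj : j ≫ π = Spec.map (CommRingCat.ofHom C)) :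
    Spec (.of K[X]) ⟶ baseChange π K :=
  pullback.lift (Spec.map (CommRingCat.ofHom (mapRingHom (algebraMap k K))) ≫ j)
    (Spec.map (CommRingCat.ofHom C))
    (by rw [Category.assoc, hj, (isPullback_SpecMap_polynomial K).w])

variable {K} {j : Spec (.of k[X]) ⟶ P} (hj : j ≫ π = Spec.map (CommRingCat.ofHom C))

@[simp]
theorem chartBaseChange_fst : chartBaseChange (K := K) hj ≫ pullback.fst _ _ =
    Spec.map (CommRingCat.ofHom (mapRingHom (algebraMap k K))) ≫ j :=
  pullback.lift_fst _ _ _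

@[simp]
theorem chartBaseChange_snd : chartBaseChange (K := K) hj ≫ baseChangeStr π K =
    Spec.map (CommRingCat.ofHom C) :=
  pullback.lift_snd _ _ _

/-- The base change of a chart is its preimage under the projection of the base change. -/
theorem isPullback_chartBaseChange :
    IsPullback (Spec.map (CommRingCat.ofHom (mapRingHom (algebraMap k K))))
      (chartBaseChange (K := K) hj) j (pullback.fst _ _) := by
  have s := isPullback_SpecMap_polynomial (k := k) K
  rw [← chartBaseChange_snd hj, ← hj] at s
  exact IsPullback.of_bot s (chartBaseChange_fst hj).symm
    (IsPullback.of_hasPullback π (Spec.map (CommRingCat.ofHom (algebraMap k K))))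

theorem isOpenImmersion_chartBaseChange [IsOpenImmersion j] :
    IsOpenImmersion (chartBaseChange (K := K) hj) :=
  MorphismProperty.of_isPullback (P := @IsOpenImmersion) (isPullback_chartBaseChange hj)
    inferInstance

theorem mem_range_chartBaseChange (p : baseChange π K) :
    p ∈ Set.range (chartBaseChange (K := K) hj) ↔
      pullback.fst π (Spec.map (CommRingCat.ofHom (algebraMap k K))) p ∈ Set.range j := by
  have h := isPullback_chartBaseChange (K := K) hj
  constructor
  · rintro ⟨q, rfl⟩
    exact ⟨_, by rw [← Scheme.Hom.comp_apply, h.w, Scheme.Hom.comp_apply]⟩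
  · rintro ⟨q, hq⟩
    obtain ⟨r, -, hr⟩ := Scheme.Pullback.exists_preimage_pullback q p hq
    refine ⟨h.isoPullback.inv r, ?_⟩
    rw [← Scheme.Hom.comp_apply, h.isoPullback_inv_snd, hr]

/-- The charts of the base change of a projective line. -/
def ProjectiveLineCharts.baseChange (c : ProjectiveLineCharts π) (K : Type u) [Field K]
    [Algebra k K] : ProjectiveLineCharts (baseChangeStr π K) :=
  have := c.isOpenImmersion_zero
  have := c.isOpenImmersion_infty
  { zero := chartBaseChange K c.zero_comp
    infty := chartBaseChange K c.infty_comp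
    isOpenImmersion_zero := isOpenImmersion_chartBaseChange _
    isOpenImmersion_infty := isOpenImmersion_chartBaseChange _
    zero_comp := chartBaseChange_snd _
    infty_comp := chartBaseChange_snd _
    cover p := by
      rw [mem_range_chartBaseChange, mem_range_chartBaseChange]
      exact c.cover _
    mem_range_zero_iff z := by
      rw [mem_range_chartBaseChange, ← Scheme.Hom.comp_apply, chartBaseChange_fst,
        Scheme.Hom.comp_apply, c.mem_range_zero_iff]
      change (mapRingHom (algebraMap k K)) X ∉ z.asIdeal ↔ _
      rw [coe_mapRingHom, map_X]
    overlap R _ σ v := by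
      have hC (w : R) : Spec.map (CommRingCat.ofHom (eval₂RingHom σ w)) ≫
          Spec.map (CommRingCat.ofHom (C : K →+* K[X])) = Spec.map (CommRingCat.ofHom σ) := by
        rw [← Spec.map_comp, ← CommRingCat.ofHom_comp]
        congr 2
        ext x
        simp
      have hm (w : R) : Spec.map (CommRingCat.ofHom (eval₂RingHom σ w)) ≫
          Spec.map (CommRingCat.ofHom (mapRingHom (algebraMap k K))) =
            Spec.map (CommRingCat.ofHom (eval₂RingHom (σ.comp (algebraMap k K)) w)) := by
        rw [← Spec.map_comp, ← CommRingCat.ofHom_comp]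
        congr 2
        ext x <;> simp
      apply pullback.hom_ext
      · rw [Category.assoc, Category.assoc, chartBaseChange_fst, chartBaseChange_fst]
        rw [reassoc_of% hm, reassoc_of% hm, c.overlap]
      · rw [Category.assoc, Category.assoc, chartBaseChange_snd, chartBaseChange_snd, hC, hC] }

end ChartsBaseChange

/-! ### The charts of `Proj k[x₀, x₁]` -/

section ProjCharts

attribute [local instance] MvPolynomial.gradedAlgebra

open HomogeneousLocalization

/-- A ring homomorphism under which `f` becomes invertible, evaluated on homogeneous fractions. -/
def evalAway {A R σ : Type*} [CommRing A] [CommRing R] [SetLike σ A] [AddSubgroupClass σ A]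
    (𝒜 : ℕ → σ) [GradedRing 𝒜] (τ : A →+* R) {f : A} (hf : IsUnit (τ f)) : Away 𝒜 f →+* R :=
  (Localization.awayLift τ f hf).comp (algebraMap (Away 𝒜 f) (Localization.Away f))

section EvalAway

variable {A R σ : Type*} [CommRing A] [CommRing R] [SetLike σ A] [AddSubgroupClass σ A]
    (𝒜 : ℕ → σ) [GradedRing 𝒜] (τ : A →+* R) {f : A} (hf : IsUnit (τ f))

theorem evalAway_mk_mul {d : ℕ} (hfd : f ∈ 𝒜 d) (n : ℕ) (a : A) (ha : a ∈ 𝒜 (n • d)) :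
    evalAway 𝒜 τ hf (Away.mk 𝒜 hfd n a ha) * τ f ^ n = τ a := by
  have h : (Away.mk 𝒜 hfd n a ha).val * algebraMap A (Localization.Away f) (f ^ n) =
      algebraMap A (Localization.Away f) a := by
    rw [Away.val_mk, Localization.mk_eq_mk']
    exact IsLocalization.mk'_spec (Localization.Away f) a
      (⟨f ^ n, n, rfl⟩ : Submonoid.powers f)
  have h' := congrArg (Localization.awayLift τ f hf) h
  have hl (b : A) : Localization.awayLift τ f hf (algebraMap A (Localization.Away f) b) = τ b :=
    IsLocalization.Away.lift_eq f hf b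
  rw [map_mul, hl, hl, map_pow] at h'
  exact h'

theorem val_fromZeroRingHom (a : 𝒜 0) : (fromZeroRingHom 𝒜 (Submonoid.powers f) a).val =
    algebraMap A (Localization.Away f) a :=
  Localization.mk_one_eq_algebraMap (M := Submonoid.powers f) (a : A)

theorem evalAway_fromZeroRingHom (a : 𝒜 0) :
    evalAway 𝒜 τ hf (fromZeroRingHom 𝒜 (Submonoid.powers f) a) = τ a :=
  (congrArg (Localization.awayLift τ f hf) (val_fromZeroRingHom 𝒜 a)).trans
    (IsLocalization.Away.lift_eq f hf _)

/-- Evaluation is compatible with enlarging the denominators. -/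
theorem evalAway_awayMap {d : ℕ} {g x : A} (hg : g ∈ 𝒜 d) (hx : x = f * g) (hτ : IsUnit (τ x))
    (z : Away 𝒜 f) : evalAway 𝒜 τ hτ (awayMap 𝒜 hg hx z) = evalAway 𝒜 τ hf z := by
  change Localization.awayLift τ x hτ (awayMap 𝒜 hg hx z).val = Localization.awayLift τ f hf z.val
  rw [val_awayMap, ← RingHom.comp_apply]
  congr 1
  refine IsLocalization.ringHom_ext (Submonoid.powers f) (RingHom.ext fun a => ?_)
  have h1 : Localization.awayLift (algebraMap A (Localization.Away x)) f
      (isUnit_of_dvd_unit (map_dvd _ ⟨_, hx⟩) (IsLocalization.Away.algebraMap_isUnit x))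
      (algebraMap A (Localization.Away f) a) = algebraMap A (Localization.Away x) a :=
    IsLocalization.Away.lift_eq f _ a
  rw [RingHom.comp_apply, RingHom.comp_apply, h1, RingHom.comp_apply]
  exact (IsLocalization.Away.lift_eq x hτ a).trans (IsLocalization.Away.lift_eq f hf a).symm

end EvalAway

/-- Homogeneous polynomials scale by a power of the scaling factor. -/
theorem _root_.MvPolynomial.IsHomogeneous.eval₂_mul_left {R S ι : Type*} [CommSemiring R]
    [CommSemiring S] {p : MvPolynomial ι R} {n : ℕ} (hp : p.IsHomogeneous n) (g : R →+* S)
    (s : S) (x : ι → S) :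
    MvPolynomial.eval₂ g (fun i => s * x i) p = s ^ n * MvPolynomial.eval₂ g x p := by
  rw [MvPolynomial.eval₂_eq, MvPolynomial.eval₂_eq, Finset.mul_sum]
  refine Finset.sum_congr rfl fun d hd => ?_
  have h : ∑ i ∈ d.support, d i = n := by
    rw [← hp (MvPolynomial.mem_support_iff.mp hd), Finsupp.weight_apply, Finsupp.sum]
    simp
  simp only [mul_pow, Finset.prod_mul_distrib]
  rw [Finset.prod_pow_eq_pow_sum, h, mul_left_comm]

variable (k : Type u) [Field k]

variable {k} in
theorem X_mem_homogeneousSubmodule (i : Fin 2) :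
    (MvPolynomial.X i : MvPolynomial (Fin 2) k) ∈ MvPolynomial.homogeneousSubmodule (Fin 2) k 1 :=
  MvPolynomial.isHomogeneous_X k i

/-- The constants, inside the ring of homogeneous fractions. -/
def constAway (f : MvPolynomial (Fin 2) k) :
    k →+* Away (MvPolynomial.homogeneousSubmodule (Fin 2) k) f :=
  (fromZeroRingHom _ (Submonoid.powers f)).comp
    (algebraMap k (MvPolynomial.homogeneousSubmodule (Fin 2) k 0))

/-- The homomorphism from polynomials to homogeneous fractions that substitutes `x_l / x_i` for the
variable. -/
def polyToAway (i l : Fin 2) :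
    Polynomial k →+* Away (MvPolynomial.homogeneousSubmodule (Fin 2) k) (MvPolynomial.X i) :=
  Polynomial.eval₂RingHom (constAway k (MvPolynomial.X i))
    (Away.isLocalizationElem (X_mem_homogeneousSubmodule i) (X_mem_homogeneousSubmodule l))

variable {k}

/-- Evaluating at homogeneous coordinates `τ` amounts to evaluating polynomials in `x_l / x_i` at
the ratio `w = τ(x_l) / τ(x_i)`. -/
theorem evalAway_comp_polyToAway {R : Type*} [CommRing R] (τ : MvPolynomial (Fin 2) k →+* R)
    {i l : Fin 2} (hi : IsUnit (τ (MvPolynomial.X i))) {w : R}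
    (hw : w * τ (MvPolynomial.X i) = τ (MvPolynomial.X l)) :
    (evalAway (MvPolynomial.homogeneousSubmodule (Fin 2) k) τ hi).comp (polyToAway k i l) =
      Polynomial.eval₂RingHom (τ.comp MvPolynomial.C) w := by
  apply Polynomial.ringHom_ext
  · intro a
    rw [RingHom.comp_apply, polyToAway, Polynomial.coe_eval₂RingHom, Polynomial.eval₂_C,
      Polynomial.coe_eval₂RingHom, Polynomial.eval₂_C]
    exact evalAway_fromZeroRingHom _ τ hi _
  · rw [RingHom.comp_apply, polyToAway, Polynomial.coe_eval₂RingHom, Polynomial.eval₂_X,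
      Polynomial.coe_eval₂RingHom, Polynomial.eval₂_X]
    have h := evalAway_mk_mul (MvPolynomial.homogeneousSubmodule (Fin 2) k) τ hi
      (X_mem_homogeneousSubmodule i) 1 (MvPolynomial.X l ^ 1)
      (by simpa using X_mem_homogeneousSubmodule l)
    have h2 : τ (MvPolynomial.X l ^ 1) = w * τ (MvPolynomial.X i) ^ 1 := by
      rw [pow_one, pow_one, hw]
    exact (hi.pow 1).mul_right_cancel (h.trans h2)

/-- Setting the variable `x_i` to `1`. -/
def dehomogenize (k : Type u) [Field k] (i : Fin 2) : MvPolynomial (Fin 2) k →+* Polynomial k :=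
  MvPolynomial.eval₂Hom Polynomial.C fun j => if j = i then 1 else Polynomial.X

/-- A form of degree `n` is `x_i ^ n` times its dehomogenization at `x_l / x_i`. -/
theorem val_polyToAway_dehomogenize {i l : Fin 2} (hil : i ≠ l) {n : ℕ}
    {a : MvPolynomial (Fin 2) k} (ha : a.IsHomogeneous n) :
    algebraMap (MvPolynomial (Fin 2) k) (Localization.Away (MvPolynomial.X i)) a =
      algebraMap (MvPolynomial (Fin 2) k) (Localization.Away (MvPolynomial.X i))
        (MvPolynomial.X i) ^ n * (polyToAway k i l (dehomogenize k i a)).val := by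
  let L := Localization.Away (MvPolynomial.X i : MvPolynomial (Fin 2) k)
  let ρ : Polynomial k →+* L := (algebraMap (Away _ _) L).comp (polyToAway k i l)
  have hC (c : k) : ρ (Polynomial.C c) = algebraMap (MvPolynomial (Fin 2) k) L (MvPolynomial.C c) := by
    have : polyToAway k i l (Polynomial.C c) = constAway k (MvPolynomial.X i) c :=
      Polynomial.eval₂_C _ _
    exact (congrArg HomogeneousLocalization.val this).trans (val_fromZeroRingHom _ _)
  have hX : algebraMap (MvPolynomial (Fin 2) k) L (MvPolynomial.X i) * ρ Polynomial.X =
      algebraMap (MvPolynomial (Fin 2) k) L (MvPolynomial.X l) := by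
    have : polyToAway k i l Polynomial.X = Away.isLocalizationElem
        (X_mem_homogeneousSubmodule i) (X_mem_homogeneousSubmodule l) :=
      Polynomial.eval₂_X _ _
    have h2 : ρ Polynomial.X = _ := congrArg HomogeneousLocalization.val this
    have h3 (m : Fin 2) : algebraMap (MvPolynomial (Fin 2) k) L (MvPolynomial.X m) =
        algebraMap (MvPolynomial (Fin 2) k) L (MvPolynomial.X m ^ 1) := by rw [pow_one]
    rw [h2, Away.val_mk, Localization.mk_eq_mk', mul_comm, h3, h3]
    exact IsLocalization.mk'_spec L (MvPolynomial.X l ^ 1 : MvPolynomial (Fin 2) k)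
      (⟨MvPolynomial.X i ^ 1, 1, rfl⟩ : Submonoid.powers (MvPolynomial.X i))
  have h1 : algebraMap (MvPolynomial (Fin 2) k) L = MvPolynomial.eval₂Hom
      (ρ.comp Polynomial.C) (fun j => algebraMap (MvPolynomial (Fin 2) k) L (MvPolynomial.X i) *
        ρ (if j = i then 1 else Polynomial.X)) := by
    apply MvPolynomial.ringHom_ext
    · intro c
      simp [hC]
    · intro j
      rw [MvPolynomial.coe_eval₂Hom, MvPolynomial.eval₂_X]
      split_ifs with hj
      · rw [hj, map_one, mul_one]
      · have : j = l := by omega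
        rw [hX, this]
  have h2 : ρ.comp (dehomogenize k i) = MvPolynomial.eval₂Hom
      (ρ.comp Polynomial.C) (fun j => ρ (if j = i then 1 else Polynomial.X)) := by
    apply MvPolynomial.ringHom_ext <;> intro j <;> simp [dehomogenize]
  have h3 := ha.eval₂_mul_left (ρ.comp Polynomial.C) (algebraMap (MvPolynomial (Fin 2) k) L (MvPolynomial.X i))
    (fun j => ρ (if j = i then 1 else Polynomial.X))
  rw [← MvPolynomial.coe_eval₂Hom, ← MvPolynomial.coe_eval₂Hom, ← h1, ← h2] at h3
  exact h3

/-- The ring of homogeneous fractions with denominators powers of `x_i` is the polynomial ring in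
`x_l / x_i`: dehomogenizing is inverse to substituting. -/
theorem polyToAway_bijective {i l : Fin 2} (hil : i ≠ l) :
    Function.Bijective (polyToAway k i l) := by
  constructor
  · have hi : dehomogenize k i (MvPolynomial.X i) = 1 := by simp [dehomogenize]
    have h := evalAway_comp_polyToAway (dehomogenize k i) (i := i) (l := l) (w := Polynomial.X)
      (by rw [hi]; exact isUnit_one) (by simp [dehomogenize, hil.symm])
    have h2 : Polynomial.eval₂RingHom ((dehomogenize k i).comp MvPolynomial.C) Polynomial.X =
        RingHom.id (Polynomial k) := by
      ext <;> simp [dehomogenize]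
    rw [h2] at h
    exact Function.LeftInverse.injective (g := evalAway _ (dehomogenize k i) (hi ▸ isUnit_one))
      fun p => RingHom.congr_fun h p
  · intro z
    obtain ⟨n, a, ha, rfl⟩ := Away.mk_surjective _ (X_mem_homogeneousSubmodule i) z
    refine ⟨dehomogenize k i a, HomogeneousLocalization.val_injective _ ?_⟩
    have ha' : a.IsHomogeneous n := by
      rw [← MvPolynomial.mem_homogeneousSubmodule]
      simpa using ha
    have h := val_polyToAway_dehomogenize hil ha'
    rw [Away.val_mk, Localization.mk_eq_mk', eq_comm, IsLocalization.mk'_eq_iff_eq_mul, h,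
      ← map_pow, mul_comm]

variable (k) in
/-- The affine chart `x_i ≠ 0` of the projective line, with coordinate `x_l / x_i`. -/
def projLineChart {i l : Fin 2} (hil : i ≠ l) : Spec (.of (Polynomial k)) ⟶
      Proj (MvPolynomial.homogeneousSubmodule (Fin 2) k) :=
  Spec.map (CommRingCat.ofHom
    (RingEquiv.ofBijective _ (polyToAway_bijective (k := k) hil)).symm.toRingHom) ≫
    Proj.awayι _ _ (X_mem_homogeneousSubmodule i) one_pos

theorem SpecMap_polyToAway_projLineChart {i l : Fin 2} (hil : i ≠ l) :
    Spec.map (CommRingCat.ofHom (polyToAway k i l)) ≫ projLineChart k hil =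
      Proj.awayι _ _ (X_mem_homogeneousSubmodule i) one_pos := by
  rw [projLineChart, ← Spec.map_comp_assoc, ← CommRingCat.ofHom_comp]
  have : (polyToAway k i l).comp
      (RingEquiv.ofBijective _ (polyToAway_bijective (k := k) hil)).symm.toRingHom =
      RingHom.id _ :=
    RingHom.ext (RingEquiv.ofBijective _ (polyToAway_bijective (k := k) hil)).apply_symm_apply
  rw [this]
  exact (congrArg (· ≫ _) (Spec.map_id _)).trans (Category.id_comp _)

instance {i l : Fin 2} (hil : i ≠ l) : IsOpenImmersion (projLineChart k hil) := by
  have : IsIso (CommRingCat.ofHom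
      (RingEquiv.ofBijective _ (polyToAway_bijective (k := k) hil)).symm.toRingHom) :=
    (RingEquiv.ofBijective _ (polyToAway_bijective (k := k) hil)).symm.toCommRingCatIso.isIso_hom
  unfold projLineChart
  infer_instance

theorem range_projLineChart {i l : Fin 2} (hil : i ≠ l) :
    Set.range (projLineChart k hil) =
      (Proj.basicOpen (MvPolynomial.homogeneousSubmodule (Fin 2) k) (MvPolynomial.X i) :
        Set (Proj (MvPolynomial.homogeneousSubmodule (Fin 2) k))) := by
  have : IsIso (CommRingCat.ofHom
      (RingEquiv.ofBijective _ (polyToAway_bijective (k := k) hil)).symm.toRingHom) :=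
    (RingEquiv.ofBijective _ (polyToAway_bijective (k := k) hil)).symm.toCommRingCatIso.isIso_hom
  have h : (projLineChart k hil).opensRange = _ :=
    (Scheme.Hom.opensRange_comp_of_isIso _ _).trans
    (Proj.opensRange_awayι (MvPolynomial.homogeneousSubmodule (Fin 2) k) _
      (X_mem_homogeneousSubmodule i) one_pos)
  exact congrArg TopologicalSpace.Opens.carrier h

theorem projLineChart_comp {i l : Fin 2} (hil : i ≠ l) :
    projLineChart k hil ≫ Proj.toSpecZero (MvPolynomial.homogeneousSubmodule (Fin 2) k) ≫
      Spec.map (CommRingCat.ofHom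
        (algebraMap k (MvPolynomial.homogeneousSubmodule (Fin 2) k 0))) =
      Spec.map (CommRingCat.ofHom Polynomial.C) := by
  have h := Proj.awayι_toSpecZero (MvPolynomial.homogeneousSubmodule (Fin 2) k) _
    (X_mem_homogeneousSubmodule i) one_pos
  rw [projLineChart, Category.assoc, reassoc_of% h, ← Spec.map_comp, ← Spec.map_comp,
    ← CommRingCat.ofHom_comp, ← CommRingCat.ofHom_comp]
  congr 2
  refine RingHom.ext fun a => (RingEquiv.symm_apply_eq
    (RingEquiv.ofBijective _ (polyToAway_bijective (k := k) hil))).mpr ?_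
  exact (Polynomial.eval₂_C _ _).symm

/-- The point with coordinate `w = τ(x_l) / τ(x_i)` in a chart is the point with homogeneous
coordinates `τ`, computed in the overlap `x₀ x₁ ≠ 0`; this no longer depends on the chart. -/
theorem SpecMap_eval₂RingHom_projLineChart {R : Type u} [CommRing R]
    (τ : MvPolynomial (Fin 2) k →+* R) {i l : Fin 2} (hil : i ≠ l)
    (hi : IsUnit (τ (MvPolynomial.X i)))
    (hx : IsUnit (τ (MvPolynomial.X 0 * MvPolynomial.X 1))) {w : R}
    (hw : w * τ (MvPolynomial.X i) = τ (MvPolynomial.X l)) :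
    Spec.map (CommRingCat.ofHom (Polynomial.eval₂RingHom (τ.comp MvPolynomial.C) w)) ≫
      projLineChart k hil =
    Spec.map (CommRingCat.ofHom
      (evalAway (MvPolynomial.homogeneousSubmodule (Fin 2) k) τ hx)) ≫
      Proj.awayι _ _ (SetLike.mul_mem_graded (X_mem_homogeneousSubmodule 0)
        (X_mem_homogeneousSubmodule 1)) two_pos := by
  have hx' : (MvPolynomial.X 0 * MvPolynomial.X 1 : MvPolynomial (Fin 2) k) =
      MvPolynomial.X i * MvPolynomial.X l := by
    fin_cases i <;> fin_cases l <;> first | exact absurd rfl hil | rfl | exact mul_comm _ _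
  rw [← evalAway_comp_polyToAway τ hi hw, CommRingCat.ofHom_comp, Spec.map_comp, Category.assoc,
    SpecMap_polyToAway_projLineChart]
  have h := Proj.SpecMap_awayMap_awayι (MvPolynomial.homogeneousSubmodule (Fin 2) k)
    (X_mem_homogeneousSubmodule i) one_pos (X_mem_homogeneousSubmodule l) hx'
  refine Eq.trans ?_ (congrArg (Spec.map (CommRingCat.ofHom
      (evalAway (MvPolynomial.homogeneousSubmodule (Fin 2) k) τ hx)) ≫ ·) h)
  rw [← Spec.map_comp_assoc, ← CommRingCat.ofHom_comp]
  congr 3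
  exact RingHom.ext fun z => (evalAway_awayMap _ τ hi (X_mem_homogeneousSubmodule l) hx' hx z).symm

theorem iSup_basicOpen_X_eq_top :
    ⨆ i : Fin 2, Proj.basicOpen (MvPolynomial.homogeneousSubmodule (Fin 2) k)
      (MvPolynomial.X i) = ⊤ := by
  refine Proj.iSup_basicOpen_eq_top' _ _ (fun i => ⟨1, X_mem_homogeneousSubmodule i⟩)
    (top_unique fun p _ => ?_)
  induction p using MvPolynomial.induction_on with
  | C a =>
    exact Subalgebra.algebraMap_mem
      (Algebra.adjoin (MvPolynomial.homogeneousSubmodule (Fin 2) k 0) (Set.range MvPolynomial.X))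
      (algebraMap k (MvPolynomial.homogeneousSubmodule (Fin 2) k 0) a)
  | add p q hp hq => exact add_mem (hp trivial) (hq trivial)
  | mul_X p i hp => exact mul_mem (hp trivial) (Algebra.subset_adjoin ⟨i, rfl⟩)

theorem projLineChart_mem_range_iff (z : Spec (.of (Polynomial k))) :
    projLineChart k (one_ne_zero (α := Fin 2)) z ∈
      Set.range (projLineChart k (zero_ne_one (α := Fin 2))) ↔ Polynomial.X ∉ z.asIdeal := by
  rw [range_projLineChart]
  have h := Proj.awayι_preimage_basicOpen (MvPolynomial.homogeneousSubmodule (Fin 2) k)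
    (X_mem_homogeneousSubmodule 1) one_pos (X_mem_homogeneousSubmodule 0) one_pos
  let E := RingEquiv.ofBijective _ (polyToAway_bijective (k := k) (one_ne_zero (α := Fin 2)))
  have h2 := SetLike.ext_iff.mp h (Spec.map (CommRingCat.ofHom E.symm.toRingHom) z)
  have h3 : E.symm (Away.isLocalizationElem (X_mem_homogeneousSubmodule 1)
      (X_mem_homogeneousSubmodule 0)) = Polynomial.X :=
    (RingEquiv.symm_apply_eq _).mpr (Polynomial.eval₂_X _ _).symm
  refine h2.trans ?_
  change E.symm _ ∉ z.asIdeal ↔ _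
  rw [h3]

variable (k) in
/-- The standard charts of `ℙ¹`, with coordinates `x₁ / x₀` and `x₀ / x₁`. -/
def projLineCharts : ProjectiveLineCharts (P := Proj (MvPolynomial.homogeneousSubmodule (Fin 2) k))
    (projLineStr k) where
  zero := projLineChart k (zero_ne_one (α := Fin 2))
  infty := projLineChart k (one_ne_zero (α := Fin 2))
  isOpenImmersion_zero := inferInstance
  isOpenImmersion_infty := inferInstance
  zero_comp := projLineChart_comp _
  infty_comp := projLineChart_comp _
  cover p := by
    rw [range_projLineChart, range_projLineChart]
    have h : p ∈ (⨆ i : Fin 2, Proj.basicOpen (MvPolynomial.homogeneousSubmodule (Fin 2) k)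
        (MvPolynomial.X i)) := by
      rw [iSup_basicOpen_X_eq_top]
      trivial
    obtain ⟨i, hi⟩ := TopologicalSpace.Opens.mem_iSup.mp h
    fin_cases i
    exacts [.inl hi, .inr hi]
  mem_range_zero_iff := projLineChart_mem_range_iff
  overlap R _ σ v := by
    -- both sides are the `R`-valued point with homogeneous coordinates `(1, v)`
    let τ : MvPolynomial (Fin 2) k →+* R := MvPolynomial.eval₂Hom σ ![1, (v : R)]
    have h0 : τ (MvPolynomial.X 0) = 1 := by simp [τ]
    have h1 : τ (MvPolynomial.X 1) = v := by simp [τ]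
    have hC : τ.comp MvPolynomial.C = σ := by ext; simp [τ]
    have hx : IsUnit (τ (MvPolynomial.X 0 * MvPolynomial.X 1)) := by
      rw [map_mul, h0, h1, one_mul]
      exact v.isUnit
    have e0 := SpecMap_eval₂RingHom_projLineChart τ (zero_ne_one (α := Fin 2))
      (by rw [h0]; exact isUnit_one) hx (w := v) (by rw [h0, h1, mul_one])
    have e1 := SpecMap_eval₂RingHom_projLineChart τ (one_ne_zero (α := Fin 2))
      (by rw [h1]; exact v.isUnit) hx (w := ((v⁻¹ : Rˣ) : R)) (by rw [h0, h1, Units.inv_mul])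
    rw [hC] at e0 e1
    exact e0.trans e1.symm

end ProjCharts

/-! ### The product with a projective line -/

section ProductProjectiveLine

variable {k : Type u} [Field k] {P : Scheme.{u}} {π : P ⟶ Spec (.of k)}

/-- The origin of the first chart is a rational point. -/
theorem ProjectiveLineCharts.exists_section (c : ProjectiveLineCharts π) :
    ∃ y : Spec (.of k) ⟶ P, y ≫ π = 𝟙 _ := by
  refine ⟨Spec.map (CommRingCat.ofHom (Polynomial.evalRingHom 0)) ≫ c.zero, ?_⟩
  rw [Category.assoc, c.zero_comp, ← Spec.map_comp, ← CommRingCat.ofHom_comp, ← Spec.map_id]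
  congr 2
  ext x
  simp

theorem prodDivisor_top {X Y S : Scheme.{u}} (πX : X ⟶ S) (πY : Y ⟶ S) (D : X.IdealSheafData) :
    prodDivisor πX πY D ⊤ = D.comap (pullback.fst πX πY) := by
  rw [prodDivisor, Scheme.IdealSheafData.comap_top, ← Scheme.IdealSheafData.one_eq_top, one_mul]

/-- A projective line carries the empty divisor, for which the hypotheses of
`pushforwardInducesIso_fst_of_degree` hold over every extension of the base field. -/
theorem pushforwardInducesIso_fst_of_projectiveLineCharts {X : Scheme.{u}}
    (πX : X ⟶ Spec (.of k)) [IsProper πX] [IsProper π] (c : ProjectiveLineCharts π)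
    (D : X.IdealSheafData) :
    PushforwardInducesIso (pullback.fst πX π) (le_refl (D.comap (pullback.fst πX π))) := by
  obtain ⟨y, hy⟩ := c.exists_section
  have h := pushforwardInducesIso_fst_of_degree πX π (D := D) (E := ⊤)
    (fun K _ _ _ => by
      rw [baseChangeDivisor, Scheme.IdealSheafData.comap_top]
      exact degreeInducesIso_of_projectiveLineCharts (c.baseChange K))
    hy (fun t => by
      rw [Scheme.IdealSheafData.support_top]
      exact id)
  have h' {D' : (pullback πX π).IdealSheafData} (hD : prodDivisor πX π D ⊤ = D')
      (hle : D' ≤ D.comap (pullback.fst πX π)) :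
      PushforwardInducesIso (pullback.fst πX π) hle := by
    subst hD
    exact h
  exact h' (prodDivisor_top πX π D) _

end ProductProjectiveLine

end ChowModulus

end

theorem mainTheorem10 {k : Type u} [Field k] {X : Scheme.{u}} (πX : X ⟶ Spec (.of k))
    [IsProper πX] (D : X.IdealSheafData) (hD : IsEffectiveCartier D) :
    (∀ (Y : Scheme.{u}) (πY : Y ⟶ Spec (.of k)) [IsProper πY] (E : Y.IdealSheafData),
      IsEffectiveCartier E → ConnectedSpace Y →
      (∃ y : Spec (.of k) ⟶ Y, y ≫ πY = 𝟙 _ ∧ ∀ t, y t ∉ E.support) →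
      (∀ (k' : Type u) [Field k'] [Algebra k k'] [FiniteDimensional k k'],
        DegreeInducesIso (baseChangeStr πY k') (baseChangeDivisor πY k' E)) →
      PushforwardInducesIso (pullback.fst πX πY) (prodDivisor_le πX πY D E)) ∧
    PushforwardInducesIso (pullback.fst πX (projLineStr k))
      (le_refl (D.comap (pullback.fst πX (projLineStr k)))) := by
  refine ⟨fun Y πY _ E _ _ hy hdeg => ?_,
    pushforwardInducesIso_fst_of_projectiveLineCharts (π := projLineStr k) πX (projLineCharts k) D⟩
  obtain ⟨y, hy, hyE⟩ := hy
  exact pushforwardInducesIso_fst_of_degree πX πY hdeg hy hyE
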